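/- **Theorem 3 (Minimization beyond $\lambda^*$).** Let $X$ be a real reflexive Banach space, $p,\gamma>1$ with $p\neq\gamma$, and let $P_1,P_2,F:X\to\mathbb R$ be $C^1$ functionals such that: $P_1,P_2$ are $p$-homogeneous and $F$ is $\gamma$-homogeneous (i.e. $P_i(tu)=t^pP_i(u)$, $F(tu)=t^\gamma F(u)$ for $t>0$, $u\in X$); $P_2(u)\ge 0$ for all $u\ne 0$ and $F(0)=0$; there are $C_1,C_2,C_3>0$ with $P_1(u)\ge C_1\|u\|^p$, $P_2(u)\le C_2\|u\|^p$, $F(u)\le C_3\|u\|^\gamma$ for all $u\in X$; there are $u_1,u_2,u_3\in X\setminus\{0\}$ with $F(u_1)>0>F(u_2)$ and $F(u_3)=0$; $P_1$ is weakly sequentially lower semi-continuous, $P_2$ is weakly sequentially continuous and $F$ is weakly sequentially upper semi-continuous. For $\lambda\in\mathbb R$ put $H_\lambda=P_1-\lambda P_2$ and $\Phi_\lambda=\frac1p H_\lambda-\frac1\gamma F$. Let $$\mathcal N_\lambda=\{u\in X\setminus\{0\}:\Phi_\lambda'(u)u=0\},\qquad \mathcal N_\lambda^+=\Big\{u\in\mathcal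 N_\lambda:\tfrac{d^2}{dt^2}\Phi_\lambda(tu)\big|_{t=1}>0\Big\},\qquad c_\lambda^+=\inf_{\mathcal N_\lambda^+}\Phi_\lambda ,$$ $$\lambda^*=\inf\Big\{\tfrac{P_1(u)}{P_2(u)}:u\neq0,\ F(u)=0\Big\},\qquad \mu_*=\inf\Big\{\tfrac{P_1(u)}{P_2(u)}:F(u)<0\Big\},$$ where $P_1(u)/P_2(u)=+\infty$ if $P_2(u)=0$. Assume $\mu_*<\lambda^*$ and * (H1) $\lambda^*=\inf\{P_1(u)/P_2(u):u\neq0,\ F(u)\ge0\}$; * (S) if $w_n\rightharpoonup w$ in $X$ and $P_1(w_n)\to P_1(w)$, then $w_n\to w$ in $X$; * (C1) if $\lambda^*$ is achieved by $u$, then $F'(u)\ne0$; * (C2) if $\lambda^*$ is achieved by $u$, then $H_{\lambda^*}'(u)\neq0$; where "$\lambda^*$ is achieved by $u$" means that $\lambda^*<\infty$, $u\neq 0$, $F(u)\ge 0$ and $P_1(u)/P_2(u)=\lambda^*$. Then there exists $\varepsilon>0$ such that for every real $\lambda$ with $\lambda^*<\lambda<\lambda^*+\varepsilon$: $c_\lambda^+=-\infty$,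 and there is $u_\lambda\in\mathcal N_\lambda^+$ which is a local minimizer of $\Phi_\lambda$ and has the following property. If $\Phi_\lambda$ satisfies the Palais–Smale condition (every sequence $(u_n)\subset X$ such that $(\Phi_\lambda(u_n))$ is bounded and $\Phi_\lambda'(u_n)\to0$ has a convergent subsequence), then $\Phi_\lambda$ has a second nontrivial critical point $w_\lambda\notin\{0,u_\lambda\}$, of mountain-pass type: there is $v_\lambda\in X$ with $\Phi_\lambda(v_\lambda)<\Phi_\lambda(u_\lambda)$ such that $$\Phi_\lambda(w_\lambda)=\inf_{\eta}\max_{t\in[0,1]}\Phi_\lambda(\eta(t))>\Phi_\lambda(u_\lambda),$$ the infimum being over all continuous $\eta:[0,1]\to X$ with $\eta(0)=u_\lambda$, $\eta(1)=v_\lambda$. -/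

import Mathlib

open Filter Topology

namespace Nehari

/-- A normed space is reflexive when the canonical embedding into its bidual is onto. -/
def IsReflexive (X : Type*) [NormedAddCommGroup X] [NormedSpace ℝ X] : Prop :=
  Function.Surjective (NormedSpace.inclusionInDoubleDual ℝ X)

section Functionals

variable {X : Type*} [NormedAddCommGroup X] [NormedSpace ℝ X]

/-- Weak convergence `w n ⇀ a` of a sequence in `X`. -/
def WeakTendsto (w : ℕ → X) (a : X) : Prop :=
  ∀ f : StrongDual ℝ X, Tendsto (fun n => f (w n)) atTop (𝓝 (f a))

/-- `G` is weakly (sequentially) lower semi-continuous: `G a ≤ liminf G (w n)` if `w n ⇀ a`. -/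
def WeaklyLSC (G : X → ℝ) : Prop :=
  ∀ (w : ℕ → X) (a : X), WeakTendsto w a → ∀ c < G a, ∀ᶠ n in atTop, c < G (w n)

/-- `G` is weakly (sequentially) upper semi-continuous: `limsup G (w n) ≤ G a` if `w n ⇀ a`. -/
def WeaklyUSC (G : X → ℝ) : Prop :=
  ∀ (w : ℕ → X) (a : X), WeakTendsto w a → ∀ c > G a, ∀ᶠ n in atTop, G (w n) < c

/-- `G` is weakly (sequentially) continuous. -/
def WeaklyContinuous (G : X → ℝ) : Prop :=
  ∀ (w : ℕ → X) (a : X), WeakTendsto w a → Tendsto (fun n => G (w n)) atTop (𝓝 (G a))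

/-- `G` is (positively) homogeneous of degree `q`. -/
def PosHomogeneous (q : ℝ) (G : X → ℝ) : Prop :=
  ∀ t : ℝ, 0 < t → ∀ u : X, G (t • u) = t ^ q * G u

/-- The standing assumptions on the exponents `p`, `γ` and on the functionals `P₁`, `P₂`, `F`. -/
structure BasicConditions (p γ : ℝ) (P₁ P₂ F : X → ℝ) : Prop where
  one_lt_p : 1 < p
  one_lt_γ : 1 < γ
  p_ne_γ : p ≠ γ
  contDiff_P₁ : ContDiff ℝ 1 P₁
  contDiff_P₂ : ContDiff ℝ 1 P₂
  contDiff_F : ContDiff ℝ 1 F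
  hom_P₁ : PosHomogeneous p P₁
  hom_P₂ : PosHomogeneous p P₂
  hom_F : PosHomogeneous γ F
  P₂_nonneg : ∀ u : X, u ≠ 0 → 0 ≤ P₂ u
  F_zero : F 0 = 0
  le_P₁ : ∃ C > 0, ∀ u : X, C * ‖u‖ ^ p ≤ P₁ u
  P₂_le : ∃ C > 0, ∀ u : X, P₂ u ≤ C * ‖u‖ ^ p
  F_le : ∃ C > 0, ∀ u : X, F u ≤ C * ‖u‖ ^ γ
  exists_F_pos : ∃ u : X, u ≠ 0 ∧ 0 < F u
  exists_F_neg : ∃ u : X, u ≠ 0 ∧ F u < 0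
  exists_F_zero : ∃ u : X, u ≠ 0 ∧ F u = 0
  lsc_P₁ : WeaklyLSC P₁
  cont_P₂ : WeaklyContinuous P₂
  usc_F : WeaklyUSC F

/-- `H_λ = P₁ - λ P₂`. -/
def H (P₁ P₂ : X → ℝ) (lam : ℝ) (u : X) : ℝ := P₁ u - lam * P₂ u

/-- `Φ_λ = (1/p) (P₁ - λ P₂) - (1/γ) F`. -/
noncomputable def energy (p γ : ℝ) (P₁ P₂ F : X → ℝ) (lam : ℝ) (u : X) : ℝ :=
  1 / p * (P₁ u - lam * P₂ u) - 1 / γ * F u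

/-- The quotient `P₁(u) / P₂(u)`, equal to `+∞` where `P₂(u) = 0`. -/
noncomputable def quot (P₁ P₂ : X → ℝ) (u : X) : EReal :=
  open Classical in if P₂ u = 0 then ⊤ else ((P₁ u / P₂ u : ℝ) : EReal)

/-- `λ* = inf {P₁(u) / P₂(u) : u ≠ 0, F(u) = 0}`. -/
noncomputable def lambdaStar (P₁ P₂ F : X → ℝ) : EReal :=
  ⨅ u ∈ {u : X | u ≠ 0 ∧ F u = 0}, quot P₁ P₂ u

/-- `μ_* = inf {P₁(u) / P₂(u) : F(u) < 0}`. -/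
noncomputable def muStar (P₁ P₂ F : X → ℝ) : EReal :=
  ⨅ u ∈ {u : X | u ≠ 0 ∧ F u < 0}, quot P₁ P₂ u

/-- Condition (H1): `λ* = inf {P₁(u) / P₂(u) : u ≠ 0, F(u) ≥ 0}`. -/
def CondH1 (P₁ P₂ F : X → ℝ) : Prop :=
  lambdaStar P₁ P₂ F = ⨅ u ∈ {u : X | u ≠ 0 ∧ 0 ≤ F u}, quot P₁ P₂ u

/-- `λ*` is finite, equal to the real number `l`, and the infimum over `{u ≠ 0, F(u) ≥ 0}`
(equal to `λ*` by (H1)) is achieved by `u`. -/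
def AchievesLambdaStar (P₁ P₂ F : X → ℝ) (l : ℝ) (u : X) : Prop :=
  lambdaStar P₁ P₂ F = (l : EReal) ∧ u ≠ 0 ∧ 0 ≤ F u ∧ quot P₁ P₂ u = (l : EReal)

/-- Condition (C1): if `λ*` is achieved by `u` then `F'(u) ≠ 0`. -/
def CondC1 (P₁ P₂ F : X → ℝ) : Prop :=
  ∀ (l : ℝ) (u : X), AchievesLambdaStar P₁ P₂ F l u → fderiv ℝ F u ≠ 0

/-- Condition (C2): if `λ*` is achieved by `u` then `H_{λ*}'(u) ≠ 0`. -/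
def CondC2 (P₁ P₂ F : X → ℝ) : Prop :=
  ∀ (l : ℝ) (u : X), AchievesLambdaStar P₁ P₂ F l u → fderiv ℝ (H P₁ P₂ l) u ≠ 0

/-- Condition (S): if `w n ⇀ a` and `P₁ (w n) → P₁ a`, then `w n → a` in norm. -/
def CondS (P₁ : X → ℝ) : Prop :=
  ∀ (w : ℕ → X) (a : X), WeakTendsto w a →
    Tendsto (fun n => P₁ (w n)) atTop (𝓝 (P₁ a)) → Tendsto w atTop (𝓝 a)

/-- The Nehari set `{u ≠ 0 : Φ'(u) u = 0}` of a functional `Φ`. -/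
def nehari (Φ : X → ℝ) : Set X := {u | u ≠ 0 ∧ fderiv ℝ Φ u u = 0}

/-- The part of the Nehari set where the fibering map `t ↦ Φ (t u)` has a positive second
derivative at `t = 1`. -/
noncomputable def nehariPlus (Φ : X → ℝ) : Set X :=
  {u | u ∈ nehari Φ ∧ 0 < iteratedDeriv 2 (fun t : ℝ => Φ (t • u)) 1}

/-- The infimum of `Φ` over the positive part of its Nehari set, in `[-∞, +∞]`. -/
noncomputable def cPlus (Φ : X → ℝ) : EReal := ⨅ u ∈ nehariPlus Φ, (Φ u : EReal)

/-- The Palais–Smale condition. -/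
def PalaisSmale (Φ : X → ℝ) : Prop :=
  ∀ u : ℕ → X, (∃ C : ℝ, ∀ n, |Φ (u n)| ≤ C) →
    Tendsto (fun n => fderiv ℝ Φ (u n)) atTop (𝓝 0) →
    ∃ k : ℕ → ℕ, StrictMono k ∧ ∃ a : X, Tendsto (fun n => u (k n)) atTop (𝓝 a)

/-- The minimax value of `Φ` over all continuous paths from `u` to `v`. -/
noncomputable def minimaxLevel (Φ : X → ℝ) (u v : X) : EReal :=
  ⨅ η : Path u v, ⨆ t : unitInterval, (Φ (η t) : EReal)

/-- `w` is a critical point of `Φ` of mountain-pass type, starting from `u`: for some `v` with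
`Φ v < Φ u`, the minimax value over the paths from `u` to `v` lies strictly above `Φ u`,
and `w` is a critical point at that level. -/
def IsMountainPassPoint (Φ : X → ℝ) (u w : X) : Prop :=
  fderiv ℝ Φ w = 0 ∧ ∃ v : X, Φ v < Φ u ∧ (Φ u : EReal) < minimaxLevel Φ u v ∧
    (Φ w : EReal) = minimaxLevel Φ u v

end Functionals

end Nehari

open Nehari

/-! Write `l` for `λ*`; it is positive, and nothing is claimed if it is infinite. Reflexivity and
(S) give a minimizer `a`. By (C2) `F a = 0`, for otherwise `a` would be a free local minimum of
`H_l`. As `H_l ≥ 0` on `{F ≥ 0}`, (C1) and (C2) yield a direction in which `F` and `H_l` both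
increase at `a`. This gives a line through `a` on which `F` and `H_l` change sign together, and, by
compactness of almost minimizers, a constant `C` such that on `{P₁ = 1}` one has `-H_l ≤ C (-F)`
where `F < 0` and `F ≤ C H_l` where `F ≥ 0` (`exists_comparison`).

Both orders of the exponents have the shape `Φ = A/q - B/r` with `q < r`: `(A, B) = (H_λ, F)` if `p
< γ`, and `(-F, -H_λ)` if `γ < p`. On a ray where `A, B < 0`, `Φ` has a negative minimum, lying on
the positive Nehari set; its depth tends to infinity when `B` tends to `0` from below and `A` stays
away from `0`. For `λ > l` we have `H_λ(a) < 0`, so the line through `a` supplies such directions,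
and the infimum is `-∞` (`exists_low_mem_nehariPlus`).

The local minimizer comes from a well `{g ≤ 0}` keeping away from these directions. The comparison
makes `Φ_λ` coercive there and bounds it below by `-τD` on `{g = 0}`, with `D` independent of the
parameter `τ` of the well, whereas a fixed interior point `z` has `Φ_λ(z) ≤ Φ_l(z) < -τD` for small
`τ`. Paths from the minimizer to very low points must climb to `-τD`, yet some stay below `0`; so
the mountain pass level is negative and its critical point is not `0`
(`exists_localMin_and_mountainPass`). -/

open Nehari

/-! ### Weak sequential compactness in reflexive spaces -/

section Reflexive

variable {X : Type*} [NormedAddCommGroup X] [NormedSpace ℝ X]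

/-- A separable subset of a normed space is normed by countably many functionals. -/
lemma exists_seq_dual_norming {s : Set X} (hs : TopologicalSpace.IsSeparable s) :
    ∃ f : ℕ → StrongDual ℝ X, (∀ k, ‖f k‖ ≤ 1) ∧ ∀ x ∈ s, (∀ k, f k x = 0) → x = 0 := by
  obtain ⟨c, hc, hsc⟩ := hs
  rcases c.eq_empty_or_nonempty with rfl | hne
  · refine ⟨fun _ => 0, by simp, fun x hx => ?_⟩
    simpa using hsc hx
  obtain ⟨y, rfl⟩ := hc.exists_eq_range hne
  choose f hf1 hf2 using fun k => exists_dual_vector'' ℝ (y k)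
  refine ⟨f, hf1, fun x hx h0 => ?_⟩
  have hx' := hsc hx
  rw [Metric.mem_closure_iff] at hx'
  have key : ∀ ε > 0, ‖x‖ ≤ 2 * ε := by
    intro ε hε
    obtain ⟨_, ⟨k, rfl⟩, hk⟩ := hx' ε hε
    have h1 : ‖y k‖ ≤ ‖y k - x‖ := by
      have h2 : f k (y k - x) = ‖y k‖ := by
        rw [map_sub, h0, sub_zero, hf2]; simp
      calc ‖y k‖ = f k (y k - x) := h2.symm
        _ ≤ ‖f k (y k - x)‖ := Real.le_norm_self _
        _ ≤ ‖f k‖ * ‖y k - x‖ := (f k).le_opNorm _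
        _ ≤ 1 * ‖y k - x‖ := by gcongr; exact hf1 k
        _ = _ := one_mul _
    rw [dist_eq_norm] at hk
    have h3 : ‖x‖ ≤ ‖y k‖ + ‖x - y k‖ := by
      simpa using norm_add_le (y k) (x - y k)
    rw [norm_sub_rev] at h1
    linarith
  have : ‖x‖ ≤ 0 := le_of_forall_pos_le_add fun ε hε => by
    have := key (ε / 2) (by positivity)
    linarith
  simpa using this

/-- Bounded sequences of a reflexive space have weakly convergent subsequences. -/
theorem exists_weakTendsto_subseq (hX : IsReflexive X) (x : ℕ → X) (R : ℝ)
    (hR : ∀ n, ‖x n‖ ≤ R) :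
    ∃ (φ : ℕ → ℕ) (a : X), StrictMono φ ∧ WeakTendsto (fun n => x (φ n)) a := by
  set Y : Submodule ℝ X := (Submodule.span ℝ (Set.range x)).topologicalClosure with hY
  have hxY : ∀ n, x n ∈ Y := fun n =>
    Submodule.le_topologicalClosure _ (Submodule.subset_span ⟨n, rfl⟩)
  have hsep : TopologicalSpace.IsSeparable (Y : Set X) := by
    rw [hY, Submodule.topologicalClosure_coe]
    exact ((Set.countable_range x).isSeparable.span).closure
  obtain ⟨f, hf1, hf⟩ := exists_seq_dual_norming hsep
  have hcomp : IsCompact (Set.univ.pi fun _ : ℕ => Set.Icc (-R) R) :=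
    isCompact_univ_pi fun _ => isCompact_Icc
  have hmem : ∀ n, (fun k => f k (x n)) ∈ Set.univ.pi fun _ : ℕ => Set.Icc (-R) R := by
    intro n k _
    refine abs_le.mp ?_
    calc |f k (x n)| = ‖f k (x n)‖ := rfl
      _ ≤ ‖f k‖ * ‖x n‖ := (f k).le_opNorm _
      _ ≤ 1 * ‖x n‖ := by gcongr; exact hf1 k
      _ ≤ R := by simpa using hR n
  -- Diagonal extraction: along `φ` every `f k` converges. It remains to pass from these countably
  -- many functionals to all of them.
  obtain ⟨b, -, φ, hφ, hb⟩ := hcomp.isSeqCompact hmem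
  rw [tendsto_pi_nhds] at hb
  let z : ℕ → WeakDual ℝ (StrongDual ℝ X) := fun n =>
    StrongDual.toWeakDual (NormedSpace.inclusionInDoubleDual ℝ X (x (φ n)))
  set K : Set (WeakDual ℝ (StrongDual ℝ X)) :=
    WeakDual.toStrongDual ⁻¹' Metric.closedBall 0 R
  have hK : IsCompact K := WeakDual.isCompact_closedBall 0 R
  have hzK : ∀ n, z n ∈ K := by
    intro n
    have h : ‖NormedSpace.inclusionInDoubleDual ℝ X (x (φ n))‖ ≤ R :=
      (NormedSpace.double_dual_bound ℝ X _).trans (hR _)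
    exact (mem_closedBall_zero_iff (E := StrongDual ℝ (StrongDual ℝ X))).2 h
  -- Weak-* cluster points in the bidual are evaluations at points of `Y` with prescribed values `b
  -- k`. The `f k` separate `Y`, so there is only one cluster point, and compactness turns this into
  -- convergence.
  have hclust : ∀ c, MapClusterPt c atTop z → ∃ a ∈ Y, (∀ k, f k a = b k) ∧
      ∀ g : StrongDual ℝ X, c g = g a := by
    intro c hc
    have hev : ∀ g : StrongDual ℝ X, MapClusterPt (c g) atTop fun n => g (x (φ n)) := by
      intro g
      exact hc.continuousAt_comp (f := fun c : WeakDual ℝ (StrongDual ℝ X) => c g)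
        (WeakDual.eval_continuous g).continuousAt
    have huniq : ∀ (g : StrongDual ℝ X) (v : ℝ),
        Tendsto (fun n => g (x (φ n))) atTop (𝓝 v) → c g = v := by
      intro g v hv
      by_contra hne
      have h := hev g
      have hd := disjoint_nhds_nhds.mpr hne
      exact (h.clusterPt.mono hv).neBot.ne (hd.eq_bot)
    obtain ⟨a, ha⟩ := hX (WeakDual.toStrongDual c)
    have hca : ∀ g : StrongDual ℝ X, c g = g a := by
      intro g
      have := congrArg (fun T => T g) ha
      exact this.symm
    refine ⟨a, ?_, fun k => ?_, hca⟩
    · by_contra haY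
      obtain ⟨g, s, hg1, hg2⟩ := geometric_hahn_banach_closed_point Y.convex
        (Submodule.isClosed_topologicalClosure _) haY
      have hg0 : ∀ y ∈ Y, g y = 0 := by
        intro y hy
        by_contra hne
        -- A functional bounded above on a subspace vanishes there: this multiple of `y` would reach
        -- the excluded value `s`.
        have := hg1 _ (Y.smul_mem (s / g y) hy)
        rw [map_smul, smul_eq_mul, div_mul_cancel₀ _ hne] at this
        exact lt_irrefl _ this
      have h1 := huniq g 0 (by simp [hg0 _ (hxY _)])
      have h2 := hg1 0 Y.zero_mem
      rw [map_zero] at h2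
      rw [hca] at h1
      linarith
    · rw [← hca]; exact huniq _ _ (hb k)
  obtain ⟨c, -, hc⟩ := hK.exists_mapClusterPt (f := atTop) (u := z) (by simp [hzK])
  obtain ⟨a, haY, hak, hca⟩ := hclust c hc
  refine ⟨φ, a, hφ, fun g => ?_⟩
  have ht : Tendsto z atTop (𝓝 c) := by
    refine hK.tendsto_nhds_of_unique_mapClusterPt (Eventually.of_forall hzK) fun c' _ hc' => ?_
    obtain ⟨a', haY', hak', hca'⟩ := hclust c' hc'
    have : a' - a = 0 := hf _ (Y.sub_mem haY' haY) fun k => by rw [map_sub, hak, hak', sub_self]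
    have : a' = a := sub_eq_zero.mp this
    apply DFunLike.ext
    intro g
    rw [hca, hca', this]
  have := ((WeakDual.eval_continuous g).tendsto c).comp ht
  rwa [hca] at this

end Reflexive

/-! ### Ekeland's principle and the mountain pass theorem -/

/-- **Ekeland's variational principle** on a closed subset of a complete metric space. -/
theorem exists_ekeland {E : Type*} [MetricSpace E] [CompleteSpace E] {S : Set E}
    (hS : IsClosed S) {φ : E → ℝ} (hφ : LowerSemicontinuous φ) {m : ℝ} (hm : ∀ x ∈ S, m ≤ φ x)
    {ε : ℝ} (hε : 0 < ε) {x₀ : E} (hx₀ : x₀ ∈ S) :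
    ∃ x ∈ S, φ x ≤ φ x₀ ∧ ∀ y ∈ S, φ x - ε * dist x y ≤ φ y := by
  -- `T x` is the set of points below `x` in Ekeland's order. Iterated almost minimization over
  -- these nested sets shrinks their diameters to zero, and the limit has nothing else below it.
  let T : E → Set E := fun x => {y | y ∈ S ∧ φ y + ε * dist x y ≤ φ x}
  have hself : ∀ x ∈ S, x ∈ T x := fun x hx => ⟨hx, by simp⟩
  have htrans : ∀ {x y z : E}, y ∈ T x → z ∈ T y → z ∈ T x := by
    rintro x y z ⟨_, h1⟩ ⟨h2, h3⟩
    refine ⟨h2, ?_⟩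
    have := mul_le_mul_of_nonneg_left (dist_triangle x y z) hε.le
    linarith
  have hnext : ∀ (n : ℕ) (x : S), ∃ y : S, (y : E) ∈ T x ∧ ∀ z ∈ T x, φ y ≤ φ z + (1 / 2) ^ n := by
    rintro n ⟨x, hx⟩
    have hbdd : BddBelow (φ '' T x) := ⟨m, by rintro _ ⟨y, hy, rfl⟩; exact hm y hy.1⟩
    have hne : (φ '' T x).Nonempty := ⟨_, x, hself x hx, rfl⟩
    obtain ⟨_, ⟨y, hy, rfl⟩, hlt⟩ := Real.lt_sInf_add_pos hne (ε := (1 / 2) ^ n) (by positivity)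
    refine ⟨⟨y, hy.1⟩, hy, fun z hz => ?_⟩
    have := csInf_le hbdd ⟨z, hz, rfl⟩
    linarith
  choose next hnext1 hnext2 using hnext
  let xs : ℕ → S := fun n => Nat.rec ⟨x₀, hx₀⟩ (fun n y => next n y) n
  let x : ℕ → E := fun n => (xs n).1
  have hmemT : ∀ n k : ℕ, (x (n + k)) ∈ T (x n) := by
    intro n k
    induction k with
    | zero => exact hself _ (xs n).2
    | succ k ih => exact htrans (z := (x (n + (k + 1)) : E)) ih (hnext1 (n + k) (xs (n + k)))
  -- The shift is needed because `x (n + 1)` is almost minimal over `T (x n)`, which contains `T (x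
  -- (n + 1))`.
  have hdist : ∀ n : ℕ, ∀ y ∈ T (x (n + 1)), ε * dist (x (n + 1)) y ≤ (1 / 2) ^ n := by
    intro n y hy
    have h1 := hnext2 n (xs n) y (htrans (hnext1 n (xs n)) hy)
    have h2 := hy.2
    change φ (x (n + 1)) ≤ _ at h1
    linarith
  have hpow : Tendsto (fun n : ℕ => (1 / 2 : ℝ) ^ n / ε) atTop (𝓝 0) := by
    simpa using (tendsto_pow_atTop_nhds_zero_of_lt_one (r := (1 / 2 : ℝ)) (by norm_num)
      (by norm_num)).div_const ε
  have hc : CauchySeq fun n => (x (n + 1)) := by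
    refine cauchySeq_of_le_tendsto_0' (fun n => (1 / 2) ^ n / ε) (fun n k hnk => ?_) hpow
    rw [le_div_iff₀' hε]
    obtain ⟨j, rfl⟩ := Nat.exists_eq_add_of_le hnk
    have := hmemT (n + 1) j
    rw [show n + 1 + j = n + j + 1 by ring] at this
    exact hdist n _ this
  obtain ⟨a, ha⟩ := cauchySeq_tendsto_of_complete hc
  have haS : a ∈ S := hS.mem_of_tendsto ha (Eventually.of_forall fun n => (xs (n + 1)).2)
  have haT : ∀ n, a ∈ T (x n) := by
    intro n
    refine ⟨haS, le_of_forall_pos_le_add fun δ hδ => ?_⟩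
    have h1 := ha.eventually (hφ a (φ a - δ) (by linarith))
    have h2 : Tendsto (fun k => φ a - δ + ε * dist (x n) (x (k + 1))) atTop
        (𝓝 (φ a - δ + ε * dist (x n) a)) :=
      ((tendsto_const_nhds.dist ha).const_mul ε).const_add _
    have h3 : φ a - δ + ε * dist (x n) a ≤ φ (x n) := by
      refine le_of_tendsto h2 ?_
      filter_upwards [h1, eventually_ge_atTop n] with k hk hnk
      obtain ⟨j, rfl⟩ := Nat.exists_eq_add_of_le hnk
      have := (hmemT n (j + 1)).2
      rw [← add_assoc] at this
      linarith
    linarith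
  refine ⟨a, haS, ?_, fun y hy => ?_⟩
  · have := (haT 0).2
    have h0 : 0 ≤ ε * dist (x 0) a := by positivity
    change φ a + ε * dist (x 0) a ≤ φ x₀ at this
    linarith
  · by_contra! hlt
    have hyT : y ∈ T a := ⟨hy, by linarith⟩
    have h1 : Tendsto (fun n => (x (n + 1))) atTop (𝓝 y) := by
      rw [tendsto_iff_dist_tendsto_zero]
      refine squeeze_zero (fun _ => dist_nonneg) (fun n => ?_) hpow
      rw [le_div_iff₀' hε]
      exact hdist n y (htrans (haT (n + 1)) hyT)
    have := tendsto_nhds_unique ha h1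
    subst this
    simp at hlt

section MountainPass

variable {X : Type*} [NormedAddCommGroup X] [NormedSpace ℝ X]

/-- If `x n → x`, `s n → 0` and `h n → h` then the difference quotients of a strictly
differentiable function converge to the derivative. -/
lemma tendsto_strict_diff_quot {Φ : X → ℝ} {x : X} {Φ' : StrongDual ℝ X}
    (hΦ : HasStrictFDerivAt Φ Φ' x) {xs h : ℕ → X} {s : ℕ → ℝ} {h₀ : X}
    (hx : Tendsto xs atTop (𝓝 x)) (hs : Tendsto s atTop (𝓝 0)) (hs0 : ∀ n, 0 < s n)
    (hh : Tendsto h atTop (𝓝 h₀)) :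
    Tendsto (fun n => (Φ (xs n + s n • h n) - Φ (xs n)) / s n) atTop (𝓝 (Φ' h₀)) := by
  have h1 : Tendsto (fun n => (xs n + s n • h n, xs n)) atTop (𝓝 (x, x)) := by
    refine Tendsto.prodMk_nhds ?_ hx
    simpa using hx.add (hs.smul hh)
  have h2 := (hasStrictFDerivAt_iff_isLittleO.mp hΦ).comp_tendsto h1
  have h3 : (fun n => Φ (xs n + s n • h n) - Φ (xs n) - Φ' (s n • h n)) =o[atTop] s := by
    have h4 : (fun n => s n • h n) =O[atTop] s := by
      have : h =O[atTop] (fun _ => (1 : ℝ)) := hh.isBigO_one ℝ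
      simpa using (Asymptotics.isBigO_refl s atTop).smul this
    have h5 := h2.trans_isBigO (g := fun n => (xs n + s n • h n) - xs n) (k := s)
      (by simpa using h4)
    simpa [Function.comp_def] using h5
  have h6 := h3.tendsto_div_nhds_zero
  have h7 : Tendsto (fun n => Φ' (h n)) atTop (𝓝 (Φ' h₀)) := (Φ'.continuous.tendsto _).comp hh
  have h8 := h6.add h7
  rw [zero_add] at h8
  refine h8.congr fun n => ?_
  have := (hs0 n).ne'
  rw [map_smul, smul_eq_mul]
  field_simp
  ring

/-- Ekeland's principle on the space of paths gives a path `η` whose maximum `M η` cannot be lowered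
at a rate above `ε`. If the gradient exceeded `4ε` at all points with values in `[m, m + ε]`, a
continuous field along `η` would lower the maximum at a rate of at least `2ε`. -/
lemma exists_almost_critical [CompleteSpace X] {Φ : X → ℝ} (hΦ : ContDiff ℝ 1 Φ) {a v : X} {m : ℝ}
    (hm : minimaxLevel Φ a v = (m : EReal)) (ha : Φ a < m) (hv : Φ v < m) {ε : ℝ} (hε : 0 < ε) :
    ∃ x, m ≤ Φ x ∧ Φ x ≤ m + ε ∧ ‖fderiv ℝ Φ x‖ ≤ 4 * ε := by
  let M : C(unitInterval, X) → ℝ := fun η => ⨆ t, Φ (η t)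
  have hbdd : ∀ η : C(unitInterval, X), BddAbove (Set.range fun t => Φ (η t)) := fun η =>
    (isCompact_range (hΦ.continuous.comp η.continuous)).bddAbove
  have hM1 : ∀ (η : C(unitInterval, X)) t, Φ (η t) ≤ M η := fun η t => le_ciSup (hbdd η) t
  have hM2 : ∀ η : C(unitInterval, X), ∃ t, Φ (η t) = M η := by
    intro η
    obtain ⟨t, -, ht⟩ := isCompact_univ.exists_isMaxOn (Set.univ_nonempty (α := unitInterval))
      (hΦ.continuous.comp η.continuous).continuousOn
    exact ⟨t, le_antisymm (hM1 η t) (ciSup_le fun s => ht (Set.mem_univ s))⟩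
  have hMlsc : LowerSemicontinuous M :=
    lowerSemicontinuous_ciSup hbdd fun t =>
      (hΦ.continuous.comp (ContinuousEvalConst.continuous_eval_const t)).lowerSemicontinuous
  set S : Set C(unitInterval, X) := {η | η 0 = a ∧ η 1 = v} with hSdef
  have hS : IsClosed S :=
    (isClosed_eq (ContinuousEvalConst.continuous_eval_const _) continuous_const).inter
      (isClosed_eq (ContinuousEvalConst.continuous_eval_const _) continuous_const)
  have hmM : ∀ η ∈ S, m ≤ M η := by
    intro η hη
    have h1 : (m : EReal) ≤ ⨆ t : unitInterval, (Φ (η t) : EReal) := by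
      rw [← hm]
      exact iInf_le (fun η : Path a v => ⨆ t : unitInterval, (Φ (η t) : EReal)) ⟨η, hη.1, hη.2⟩
    have h2 : (⨆ t : unitInterval, (Φ (η t) : EReal)) ≤ (M η : EReal) :=
      iSup_le fun t => EReal.coe_le_coe_iff.2 (hM1 η t)
    exact EReal.coe_le_coe_iff.1 (h1.trans h2)
  obtain ⟨η₀, hη₀S, hη₀⟩ : ∃ η ∈ S, M η ≤ m + ε := by
    have h1 : minimaxLevel Φ a v < ((m + ε : ℝ) : EReal) := by
      rw [hm, EReal.coe_lt_coe_iff]; linarith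
    obtain ⟨η, hη⟩ := iInf_lt_iff.1 h1
    refine ⟨η.toContinuousMap, ⟨η.source, η.target⟩, ciSup_le fun t => ?_⟩
    have := (le_iSup (fun t : unitInterval => (Φ (η t) : EReal)) t).trans hη.le
    exact EReal.coe_le_coe_iff.1 this
  obtain ⟨η, hηS, hηle, hη⟩ := exists_ekeland hS hMlsc hmM hε hη₀S
  by_contra! hcon
  set T : Set unitInterval := {t | Φ (η t) = M η} with hT
  have hTc : IsClosed T := isClosed_eq (hΦ.continuous.comp η.continuous) continuous_const
  have hmη := hmM η hηS
  have hdir : ∀ t ∈ T, ∃ w, ‖w‖ ≤ 1 ∧ fderiv ℝ Φ (η t) w < -(2 * ε) := by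
    intro t ht
    have ht' : Φ (η t) = M η := ht
    have h1 := hcon (η t) (by linarith) (by linarith)
    obtain ⟨w, hw1, hw2⟩ := (fderiv ℝ Φ (η t)).exists_lt_apply_of_lt_opNorm
      (show 2 * ε < _ by linarith)
    rcases abs_cases (fderiv ℝ Φ (η t) w) with h | h
    · refine ⟨-w, by simpa using hw1.le, ?_⟩
      rw [Real.norm_eq_abs, h.1] at hw2
      rw [map_neg]; linarith
    · refine ⟨w, hw1.le, ?_⟩
      rw [Real.norm_eq_abs, h.1] at hw2
      linarith
  have h0T : (0 : unitInterval) ∉ T := fun h => by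
    have : Φ (η 0) = M η := h
    rw [hηS.1] at this; linarith
  have h1T : (1 : unitInterval) ∉ T := fun h => by
    have : Φ (η 1) = M η := h
    rw [hηS.2] at this; linarith
  -- All requirements on the field are convex, so a partition of unity glues locally constant
  -- choices: unit bound, descent on the maximum set `T`, zero at the endpoints.
  obtain ⟨g, hg⟩ := exists_continuous_forall_mem_convex_of_local_const
    (t := fun t : unitInterval => {w : X | (‖w‖ ≤ 1 ∧ (t ∈ T → fderiv ℝ Φ (η t) w < -(2 * ε))) ∧
      ((t = 0 → w = 0) ∧ (t = 1 → w = 0))}) (fun t => by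
      have c1 : Convex ℝ {w : X | ‖w‖ ≤ 1} := by
        simpa [Metric.closedBall, dist_zero_right] using convex_closedBall (0 : X) 1
      have c2 : Convex ℝ {w : X | t ∈ T → fderiv ℝ Φ (η t) w < -(2 * ε)} := by
        by_cases h : t ∈ T
        · simpa [h] using convex_halfSpace_lt (𝕜 := ℝ) (fderiv ℝ Φ (η t)).isLinear (-(2 * ε))
        · simp [h, convex_univ]
      have c3 : ∀ p : Prop, Convex ℝ {w : X | p → w = 0} := by
        intro p
        by_cases h : p
        · simp [h]
        · simp [h, convex_univ]
      exact (c1.inter c2).inter ((c3 _).inter (c3 _))) (fun t => by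
      by_cases ht : t ∈ T
      · obtain ⟨w, hw1, hw2⟩ := hdir t ht
        refine ⟨w, ?_⟩
        have hc : Continuous fun s : unitInterval => fderiv ℝ Φ (η s) w :=
          ((hΦ.continuous_fderiv one_ne_zero).comp η.continuous).clm_apply continuous_const
        have e1 := hc.continuousAt.eventually_lt (continuousAt_const (y := -(2 * ε))) hw2
        have e2 : ∀ᶠ s in 𝓝 t, s ≠ 0 := eventually_ne_nhds (fun h => h0T (h ▸ ht))
        have e3 : ∀ᶠ s in 𝓝 t, s ≠ 1 := eventually_ne_nhds (fun h => h1T (h ▸ ht))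
        filter_upwards [e1, e2, e3] with s h1 h2 h3
        exact ⟨⟨hw1, fun _ => h1⟩, fun h => absurd h h2, fun h => absurd h h3⟩
      · refine ⟨0, ?_⟩
        filter_upwards [hTc.isOpen_compl.mem_nhds ht] with s hs
        exact ⟨⟨by simp, fun h => absurd h hs⟩, fun _ => rfl, fun _ => rfl⟩)
  let s : ℕ → ℝ := fun n => 1 / ((n : ℝ) + 1)
  have hs0 : ∀ n, 0 < s n := fun n => by positivity
  have hs : Tendsto s atTop (𝓝 0) := tendsto_one_div_add_atTop_nhds_zero_nat
  have hgn : ‖g‖ ≤ 1 := (ContinuousMap.norm_le _ zero_le_one).2 fun t => (hg t).1.1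
  have hηn : ∀ n, M η - ε * s n ≤ M (η + s n • g) := by
    intro n
    have hmem : η + s n • g ∈ S := by
      refine ⟨?_, ?_⟩
      · simp [(hg 0).2.1 rfl, hηS.1]
      · simp [(hg 1).2.2 rfl, hηS.2]
    have h1 := hη _ hmem
    have h2 : dist η (η + s n • g) ≤ s n := by
      rw [dist_eq_norm, sub_add_cancel_left, norm_neg, norm_smul, Real.norm_of_nonneg (hs0 n).le]
      exact mul_le_of_le_one_right (hs0 n).le hgn
    have := mul_le_mul_of_nonneg_left h2 hε.le
    linarith
  -- Maximum points of the deformed paths accumulate at a point of `T`. There Ekeland's inequality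
  -- bounds the derivative along `g` below by `-ε`, against descent by more than `2ε`.
  choose t ht using fun n => hM2 (η + s n • g)
  obtain ⟨t₀, φ, hφ, ht₀⟩ := CompactSpace.tendsto_subseq t
  have hsφ : Tendsto (s ∘ φ) atTop (𝓝 0) := hs.comp hφ.tendsto_atTop
  have hηt : Tendsto (fun n => η (t (φ n))) atTop (𝓝 (η t₀)) :=
    (η.continuous.tendsto _).comp ht₀
  have hgt : Tendsto (fun n => g (t (φ n))) atTop (𝓝 (g t₀)) := (g.continuous.tendsto _).comp ht₀
  have ht₀T : t₀ ∈ T := by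
    refine le_antisymm (hM1 η t₀) ?_
    have h1 : Tendsto (fun n => Φ (η (t (φ n)) + s (φ n) • g (t (φ n)))) atTop
        (𝓝 (Φ (η t₀ + (0 : ℝ) • g t₀))) :=
      (hΦ.continuous.tendsto _).comp (hηt.add (hsφ.smul hgt))
    rw [zero_smul, add_zero] at h1
    have h2 : Tendsto (fun n => M η - ε * s (φ n)) atTop (𝓝 (M η - ε * 0)) :=
      (hsφ.const_mul ε).const_sub _
    rw [mul_zero, sub_zero] at h2
    refine le_of_tendsto_of_tendsto' h2 h1 fun n => ?_
    have := hηn (φ n)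
    rw [← ht (φ n)] at this
    simpa using this
  have hlim := tendsto_strict_diff_quot (hΦ.contDiffAt.hasStrictFDerivAt one_ne_zero)
    hηt hsφ (fun n => hs0 _) hgt
  have hge : -ε ≤ fderiv ℝ Φ (η t₀) (g t₀) := by
    refine ge_of_tendsto' hlim fun n => ?_
    have h1 := hηn (φ n)
    rw [← ht (φ n)] at h1
    have h2 := hM1 η (t (φ n))
    have h3 : M η - ε * s (φ n) ≤ Φ (η (t (φ n)) + s (φ n) • g (t (φ n))) := by simpa using h1
    have h4 : 0 < s (φ n) := hs0 _
    rw [Function.comp_apply, le_div_iff₀ h4]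
    linarith
  have := (hg t₀).1.2 ht₀T
  linarith

/-- The **mountain pass theorem** for `C¹` functionals satisfying the Palais–Smale condition. -/
theorem exists_critical_at_minimaxLevel [CompleteSpace X] {Φ : X → ℝ} (hΦ : ContDiff ℝ 1 Φ)
    (hPS : PalaisSmale Φ) {a v : X} {m : ℝ} (hm : minimaxLevel Φ a v = (m : EReal))
    (ha : Φ a < m) (hv : Φ v < m) : ∃ w, fderiv ℝ Φ w = 0 ∧ Φ w = m := by
  let s : ℕ → ℝ := fun n => 1 / ((n : ℝ) + 1)
  have hs0 : ∀ n, 0 < s n := fun n => by positivity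
  have hs : Tendsto s atTop (𝓝 0) := tendsto_one_div_add_atTop_nhds_zero_nat
  choose x hx1 hx2 hx3 using fun n => exists_almost_critical hΦ hm ha hv (hs0 n)
  have hder : Tendsto (fun n => fderiv ℝ Φ (x n)) atTop (𝓝 0) :=
    squeeze_zero_norm hx3 (by simpa using hs.const_mul 4)
  have hval : Tendsto (fun n => Φ (x n)) atTop (𝓝 m) :=
    tendsto_of_tendsto_of_tendsto_of_le_of_le tendsto_const_nhds
      (by simpa using hs.const_add m) hx1 hx2
  obtain ⟨C, hC⟩ := (hval.norm).bddAbove_range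
  obtain ⟨k, hk, w, hw⟩ := hPS x ⟨C, fun n => hC ⟨n, rfl⟩⟩ hder
  refine ⟨w, ?_, ?_⟩
  · exact tendsto_nhds_unique (((hΦ.continuous_fderiv one_ne_zero).tendsto w).comp hw)
      (hder.comp hk.tendsto_atTop)
  · exact tendsto_nhds_unique ((hΦ.continuous.tendsto w).comp hw) (hval.comp hk.tendsto_atTop)

end MountainPass

/-! ### Minimization in a potential well -/

section Well

variable {X : Type*} [NormedAddCommGroup X] [NormedSpace ℝ X]

/-- Converts Ekeland's inequality, needed only near `x`, into almost criticality by taking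
difference quotients along `w` and `-w`. -/
lemma norm_fderiv_le_of_eventually_sub_le {Φ : X → ℝ} (hΦ : ContDiff ℝ 1 Φ) {x : X} {ε : ℝ}
    (hε : 0 ≤ ε) (h : ∀ᶠ y in 𝓝 x, Φ x - ε * dist x y ≤ Φ y) : ‖fderiv ℝ Φ x‖ ≤ ε := by
  have key : ∀ w, -(ε * ‖w‖) ≤ fderiv ℝ Φ x w := by
    intro w
    let s : ℕ → ℝ := fun n => 1 / ((n : ℝ) + 1)
    have hs0 : ∀ n, 0 < s n := fun n => by positivity
    have hs : Tendsto s atTop (𝓝 0) := tendsto_one_div_add_atTop_nhds_zero_nat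
    have hlim := tendsto_strict_diff_quot (hΦ.hasStrictFDerivAt one_ne_zero)
      (tendsto_const_nhds (x := x)) hs hs0 (tendsto_const_nhds (x := w))
    have hx : Tendsto (fun n => x + s n • w) atTop (𝓝 x) := by
      simpa using (hs.smul_const w).const_add x
    refine ge_of_tendsto hlim ?_
    filter_upwards [hx.eventually h] with n hn
    rw [le_div_iff₀ (hs0 n)]
    rw [dist_eq_norm, sub_add_cancel_left, norm_neg, norm_smul, Real.norm_of_nonneg (hs0 n).le]
      at hn
    linarith
  refine ContinuousLinearMap.opNorm_le_bound _ hε fun w => ?_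
  rw [Real.norm_eq_abs, abs_le]
  have h1 := key (-w)
  rw [map_neg, norm_neg] at h1
  exact ⟨key w, by linarith⟩

/-- Minimization of a weakly lower semi-continuous functional on a weakly closed sublevel set on
which it is coercive. -/
lemma exists_min_on_weaklyClosed (hX : IsReflexive X) {Φ g : X → ℝ} (hΦw : WeaklyLSC Φ)
    (hgw : WeaklyLSC g) (hcoer : ∀ R, ∃ ρ, ∀ u, g u ≤ 0 → Φ u ≤ R → ‖u‖ ≤ ρ)
    (hne : ∃ z, g z ≤ 0) : ∃ u, g u ≤ 0 ∧ ∀ y, g y ≤ 0 → Φ u ≤ Φ y := by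
  obtain ⟨z, hz⟩ := hne
  obtain ⟨ρ, hρ⟩ := hcoer (Φ z)
  by_contra! hcon
  -- If the infimum is not attained, a minimizing sequence eventually drops below each value of `Φ`
  -- on the set. This form also covers an infimum equal to `-∞`.
  have hstep : ∃ s : ℕ → X, (∀ n, g (s n) ≤ 0 ∧ Φ (s n) ≤ Φ z) ∧
      ∀ y, g y ≤ 0 → ∀ᶠ n in atTop, Φ (s n) < Φ y := by
    by_cases hb : BddBelow (Φ '' {u | g u ≤ 0})
    · have hne' : (Φ '' {u | g u ≤ 0}).Nonempty := ⟨_, z, hz, rfl⟩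
      have hlt : ∀ y, g y ≤ 0 → sInf (Φ '' {u | g u ≤ 0}) < Φ y := by
        intro y hy
        obtain ⟨y', hy', hlt⟩ := hcon y hy
        exact (csInf_le hb ⟨y', hy', rfl⟩).trans_lt hlt
      obtain ⟨v, hv1, hv2, hv3⟩ := exists_seq_tendsto_sInf hne' hb
      choose s hs1 hs2 using hv3
      have ht : Tendsto (fun n => Φ (s n)) atTop (𝓝 (sInf (Φ '' {u | g u ≤ 0}))) := by
        simpa [hs2] using hv2
      obtain ⟨N, hN⟩ := eventually_atTop.1 (ht.eventually_lt_const (hlt z hz))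
      refine ⟨fun n => s (n + N), fun n => ⟨hs1 _, (hN _ (by lia)).le⟩, fun y hy => ?_⟩
      exact (tendsto_add_atTop_nat N).eventually (ht.eventually_lt_const (hlt y hy))
    · rw [not_bddBelow_iff] at hb
      have : ∀ n : ℕ, ∃ u, g u ≤ 0 ∧ Φ u < min (Φ z) (-(n : ℝ)) := by
        intro n
        obtain ⟨_, ⟨u, hu, rfl⟩, h⟩ := hb (min (Φ z) (-(n : ℝ)))
        exact ⟨u, hu, h⟩
      choose s hs1 hs2 using this
      refine ⟨s, fun n => ⟨hs1 n, (lt_min_iff.1 (hs2 n)).1.le⟩, fun y _ => ?_⟩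
      obtain ⟨N, hN⟩ := exists_nat_gt (-Φ y)
      filter_upwards [eventually_ge_atTop N] with n hn
      have h1 := (lt_min_iff.1 (hs2 n)).2
      have h2 : (N : ℝ) ≤ n := by exact_mod_cast hn
      linarith
  obtain ⟨s, hs1, hs2⟩ := hstep
  obtain ⟨φ, a, hφ, ha⟩ := exists_weakTendsto_subseq hX s ρ fun n => hρ _ (hs1 n).1 (hs1 n).2
  have hga : g a ≤ 0 := by
    by_contra! hlt
    obtain ⟨n, hn⟩ := (hgw _ a ha 0 hlt).exists
    exact hn.not_ge (hs1 _).1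
  obtain ⟨y, hy, hya⟩ := hcon a hga
  obtain ⟨n, hn1, hn2⟩ := ((hΦw _ a ha _ hya).and (hφ.tendsto_atTop.eventually (hs2 y hy))).exists
  exact hn1.not_gt hn2

/-- On a path component of an open sublevel set on which it is bounded below, a functional
satisfying the Palais–Smale condition attains its infimum. -/
lemma exists_min_on_pathComponentIn [CompleteSpace X] {Φ : X → ℝ} (hΦ : ContDiff ℝ 1 Φ)
    (hPS : PalaisSmale Φ) {e c : ℝ} {z : X} (hz : Φ z < e)
    (hc : ∀ y ∈ pathComponentIn {x | Φ x < e} z, c ≤ Φ y) :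
    ∃ u ∈ pathComponentIn {x | Φ x < e} z, ∀ y ∈ pathComponentIn {x | Φ x < e} z, Φ u ≤ Φ y := by
  set U : Set X := {x | Φ x < e} with hU
  set W := pathComponentIn U z with hW
  have hUo : IsOpen U := isOpen_lt hΦ.continuous continuous_const
  have hWo : IsOpen W := hUo.pathComponentIn z
  have hzW : z ∈ W := mem_pathComponentIn_self hz
  -- The component is closed relative to the sublevel set. Ekeland's principle can thus be run on
  -- `closure W`: the point it returns is still below `e`, hence in the open set `W`.
  have hWcl : ∀ x ∈ closure W, Φ x < e → x ∈ W := by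
    intro x hx hxe
    have h1 : pathComponentIn U x ∈ 𝓝 x := pathComponentIn_mem_nhds (hUo.mem_nhds hxe)
    obtain ⟨y, hy1, hy2⟩ := mem_closure_iff_nhds.1 hx _ h1
    exact JoinedIn.trans hy2 hy1.symm
  have hccl : ∀ x ∈ closure W, c ≤ Φ x := fun x hx =>
    closure_minimal hc (isClosed_le continuous_const hΦ.continuous) hx
  have hne : (Φ '' W).Nonempty := ⟨_, z, hzW, rfl⟩
  have hbdd : BddBelow (Φ '' W) := ⟨c, by rintro _ ⟨y, hy, rfl⟩; exact hc y hy⟩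
  set m := sInf (Φ '' W) with hm
  have hmle : ∀ y ∈ W, m ≤ Φ y := fun y hy => csInf_le hbdd ⟨y, hy, rfl⟩
  have hme : m < e := (hmle z hzW).trans_lt hz
  let s : ℕ → ℝ := fun n => 1 / ((n : ℝ) + 1)
  have hs0 : ∀ n, 0 < s n := fun n => by positivity
  have hs : Tendsto s atTop (𝓝 0) := tendsto_one_div_add_atTop_nhds_zero_nat
  have hstep : ∀ n, ∃ x ∈ W, Φ x ≤ m + s n ∧ ‖fderiv ℝ Φ x‖ ≤ s n := by
    intro n
    obtain ⟨_, ⟨y, hy, rfl⟩, hlt⟩ := Real.lt_sInf_add_pos hne (hs0 n)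
    obtain ⟨x, hx1, hx2, hx3⟩ := exists_ekeland isClosed_closure hΦ.continuous.lowerSemicontinuous
      hccl (hs0 n) (subset_closure hy)
    have hyU : Φ y < e := (show JoinedIn U z y from hy).target_mem
    have hxW := hWcl x hx1 (hx2.trans_lt hyU)
    refine ⟨x, hxW, hx2.trans hlt.le, norm_fderiv_le_of_eventually_sub_le hΦ (hs0 n).le ?_⟩
    filter_upwards [hWo.mem_nhds hxW] with y hy using hx3 y (subset_closure hy)
  choose x hx1 hx2 hx3 using hstep
  have hval : Tendsto (fun n => Φ (x n)) atTop (𝓝 m) :=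
    tendsto_of_tendsto_of_tendsto_of_le_of_le tendsto_const_nhds
      (by simpa using hs.const_add m) (fun n => hmle _ (hx1 n)) hx2
  obtain ⟨C, hC⟩ := (hval.norm).bddAbove_range
  obtain ⟨k, hk, w, hw⟩ := hPS x ⟨C, fun n => hC ⟨n, rfl⟩⟩ (squeeze_zero_norm hx3 hs)
  have hwm : Φ w = m :=
    tendsto_nhds_unique ((hΦ.continuous.tendsto w).comp hw) (hval.comp hk.tendsto_atTop)
  refine ⟨w, hWcl w (mem_closure_of_tendsto hw (Eventually.of_forall fun n => hx1 _))
    (by rw [hwm]; exact hme), fun y hy => by rw [hwm]; exact hmle y hy⟩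

/-- A potential well `{g < 0}` of `Φ` whose boundary lies at a level `e ≤ 0` above the value at
some interior point, from which arbitrarily low values of `Φ` can be reached inside `{Φ < 0}`,
contains a local minimizer which is accompanied by a mountain pass point. Under the Palais–Smale
condition the minimizer is taken in the component of `{Φ < e}` containing `z`, which keeps the
minimax level below `Φ 0 = 0`. -/
theorem exists_localMin_and_mountainPass [CompleteSpace X] (hX : IsReflexive X) {Φ g : X → ℝ}
    (hΦ : ContDiff ℝ 1 Φ) (hΦw : WeaklyLSC Φ) (hΦ0 : Φ 0 = 0) (hg : Continuous g)
    (hgw : WeaklyLSC g) (hcoer : ∀ R, ∃ ρ, ∀ u, g u ≤ 0 → Φ u ≤ R → ‖u‖ ≤ ρ) {e : ℝ} (he : e ≤ 0)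
    (hbdry : ∀ u, g u = 0 → e ≤ Φ u) {z : X} (hgz : g z < 0) (hz : Φ z < e)
    (hlow : ∀ R, ∃ v, Φ v < R ∧ JoinedIn {x | Φ x < 0} z v) :
    ∃ u, Φ u < 0 ∧ IsLocalMin Φ u ∧
      (PalaisSmale Φ → ∃ w, w ≠ 0 ∧ w ≠ u ∧ IsMountainPassPoint Φ u w) := by
  obtain ⟨u₀, hgu₀, hmin⟩ := exists_min_on_weaklyClosed hX hΦw hgw hcoer ⟨z, hgz.le⟩
  by_cases hPS : PalaisSmale Φ
  swap
  · have hlt : Φ u₀ < e := (hmin z hgz.le).trans_lt hz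
    refine ⟨u₀, hlt.trans_le he, ?_, fun h => absurd h hPS⟩
    have hgu : g u₀ < 0 := lt_of_le_of_ne hgu₀ fun h => (hbdry u₀ h).not_gt hlt
    filter_upwards [(isOpen_lt hg continuous_const).mem_nhds hgu] with y hy
    exact hmin y (le_of_lt hy)
  set U : Set X := {x | Φ x < e} with hU
  have hUo : IsOpen U := isOpen_lt hΦ.continuous continuous_const
  -- A path leaving `{g ≤ 0}` would cross `{g = 0}`, where `Φ ≥ e`.
  have hWg : ∀ y ∈ pathComponentIn U z, g y ≤ 0 := by
    intro y hy
    by_contra! hpos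
    obtain ⟨γ, hγ⟩ := hy
    have hcont : Continuous fun t => g (γ t) := hg.comp γ.continuous
    obtain ⟨t, ht⟩ := mem_range_of_exists_le_of_exists_ge hcont
      ⟨0, by simpa using hgz.le⟩ ⟨1, by simpa using hpos.le⟩
    exact (hbdry _ ht).not_gt (hγ t)
  obtain ⟨a, haW, hamin⟩ := exists_min_on_pathComponentIn hΦ hPS hz
    (c := Φ u₀) (fun y hy => hmin y (hWg y hy))
  have hae : Φ a < e := (show JoinedIn U z a from haW).target_mem
  refine ⟨a, hae.trans_le he, ?_, fun _ => ?_⟩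
  · filter_upwards [(hUo.pathComponentIn z).mem_nhds haW] with y hy using hamin y hy
  obtain ⟨v, hva, hzv⟩ := hlow (Φ a)
  have hvW : v ∉ pathComponentIn U z := fun h => (hamin v h).not_gt hva
  -- Since `v` lies below the minimum over the component, no path from `a` to `v` stays in `{Φ <
  -- e}`.
  have hge : (e : EReal) ≤ minimaxLevel Φ a v := by
    refine le_iInf fun η => ?_
    by_contra! hlt
    have hηU : ∀ t, η t ∈ U := fun t => EReal.coe_lt_coe_iff.1
      ((le_iSup (fun t : unitInterval => (Φ (η t) : EReal)) t).trans_lt hlt)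
    exact hvW (JoinedIn.trans haW ⟨η, hηU⟩)
  -- Joining `a` to `z` inside the component, then `z` to `v` inside `{Φ < 0}`, gives one path whose
  -- maximum is negative.
  have hlt0 : minimaxLevel Φ a v < ((0 : ℝ) : EReal) := by
    have hav : JoinedIn {x | Φ x < 0} a v :=
      (JoinedIn.mono haW fun x hx => lt_of_lt_of_le (a := Φ x) hx he).symm.trans hzv
    obtain ⟨η, hη⟩ := hav
    obtain ⟨t, -, ht⟩ := isCompact_univ.exists_isMaxOn (Set.univ_nonempty (α := unitInterval))
      (hΦ.continuous.comp η.continuous).continuousOn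
    refine (iInf_le _ η).trans_lt (lt_of_le_of_lt (iSup_le fun s => ?_)
      (EReal.coe_lt_coe_iff.2 (hη t)))
    exact EReal.coe_le_coe_iff.2 (ht (Set.mem_univ s))
  obtain ⟨m, hm⟩ : ∃ m : ℝ, minimaxLevel Φ a v = (m : EReal) :=
    ⟨_, (EReal.coe_toReal (hlt0.trans (EReal.coe_lt_top 0)).ne
      ((EReal.bot_lt_coe e).trans_le hge).ne').symm⟩
  rw [hm] at hge hlt0
  have hem : e ≤ m := EReal.coe_le_coe_iff.1 hge
  have hm0 : m < 0 := EReal.coe_lt_coe_iff.1 hlt0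
  obtain ⟨w, hw1, hw2⟩ := exists_critical_at_minimaxLevel hΦ hPS hm (hae.trans_le hem)
    ((hva.trans hae).trans_le hem)
  refine ⟨w, ?_, ?_, hw1, v, hva, ?_, ?_⟩
  · rintro rfl
    linarith
  · rintro rfl
    linarith
  · rw [hm]; exact EReal.coe_lt_coe_iff.2 (hae.trans_le hem)
  · rw [hm, hw2]

end Well

/-- The dilation factor which takes a direction with `A u < 0` and `B u < 0` to the Nehari set. -/
noncomputable def nehariScale {Y : Type*} (q r : ℝ) (A B : Y → ℝ) (u : Y) : ℝ :=
  (A u / B u) ^ (1 / (r - q))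

lemma nehariScale_pos {Y : Type*} {q r : ℝ} {A B : Y → ℝ} {u : Y} (hAu : A u < 0)
    (hBu : B u < 0) : 0 < nehariScale q r A B u :=
  Real.rpow_pos_of_pos (div_pos_of_neg_of_neg hAu hBu) _

/-! ### Fibering maps and the positive Nehari set -/

section Fibering

variable {X : Type*} [NormedAddCommGroup X] [NormedSpace ℝ X] {q r : ℝ} {A B Φ : X → ℝ}

lemma eq_zero_of_posHomogeneous {G : X → ℝ} (hq : 0 < q) (hG : PosHomogeneous q G) : G 0 = 0 := by
  have h := hG 2 two_pos 0
  rw [smul_zero] at h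
  have h2 : (1 : ℝ) < 2 ^ q := Real.one_lt_rpow (by norm_num) hq
  have : (2 ^ q - 1) * G 0 = 0 := by linarith
  rcases mul_eq_zero.1 this with h3 | h3
  · linarith
  · exact h3

lemma fibering_apply (hA : PosHomogeneous q A) (hB : PosHomogeneous r B)
    (hΦ : ∀ u, Φ u = 1 / q * A u - 1 / r * B u) {t : ℝ} (ht : 0 < t) (u : X) :
    Φ (t • u) = 1 / q * (t ^ q * A u) - 1 / r * (t ^ r * B u) := by
  rw [hΦ, hA t ht, hB t ht]

lemma hasDerivAt_fibering (hq : q ≠ 0) (hr : r ≠ 0) (hA : PosHomogeneous q A)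
    (hB : PosHomogeneous r B) (hΦ : ∀ u, Φ u = 1 / q * A u - 1 / r * B u) {t : ℝ} (ht : 0 < t)
    (u : X) :
    HasDerivAt (fun t : ℝ => Φ (t • u)) (t ^ (q - 1) * A u - t ^ (r - 1) * B u) t := by
  have h1 := (((Real.hasDerivAt_rpow_const (p := q) (Or.inl ht.ne')).mul_const (A u)).const_mul
    (1 / q)).sub (((Real.hasDerivAt_rpow_const (p := r) (Or.inl ht.ne')).mul_const (B u)).const_mul
    (1 / r))
  have h2 : (fun t : ℝ => Φ (t • u)) =ᶠ[𝓝 t]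
      fun t => 1 / q * (t ^ q * A u) - 1 / r * (t ^ r * B u) := by
    filter_upwards [lt_mem_nhds ht] with s hs using fibering_apply hA hB hΦ hs u
  refine (HasDerivAt.congr_of_eventuallyEq h1 h2).congr_deriv ?_
  field_simp

lemma iteratedDeriv_two_fibering (hq : q ≠ 0) (hr : r ≠ 0) (hA : PosHomogeneous q A)
    (hB : PosHomogeneous r B) (hΦ : ∀ u, Φ u = 1 / q * A u - 1 / r * B u) (u : X) :
    iteratedDeriv 2 (fun t : ℝ => Φ (t • u)) 1 = (q - 1) * A u - (r - 1) * B u := by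
  rw [iteratedDeriv_succ, iteratedDeriv_one]
  have h1 : deriv (fun t : ℝ => Φ (t • u)) =ᶠ[𝓝 1]
      fun t => t ^ (q - 1) * A u - t ^ (r - 1) * B u := by
    filter_upwards [lt_mem_nhds one_pos] with s hs
    exact (hasDerivAt_fibering hq hr hA hB hΦ hs u).deriv
  rw [h1.deriv_eq]
  have h2 := ((Real.hasDerivAt_rpow_const (x := 1) (p := q - 1) (Or.inl one_ne_zero)).mul_const
    (A u)).sub ((Real.hasDerivAt_rpow_const (x := 1) (p := r - 1)
    (Or.inl one_ne_zero)).mul_const (B u))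
  exact h2.deriv.trans (by simp)

lemma fderiv_apply_self (hq : q ≠ 0) (hr : r ≠ 0) (hA : PosHomogeneous q A)
    (hB : PosHomogeneous r B) (hΦ : ∀ u, Φ u = 1 / q * A u - 1 / r * B u)
    (hd : Differentiable ℝ Φ) (u : X) : fderiv ℝ Φ u u = A u - B u := by
  have h1 := hasDerivAt_fibering hq hr hA hB hΦ one_pos u
  have h2 : HasDerivAt (fun t : ℝ => t • u) u 1 := by
    simpa using (hasDerivAt_id (1 : ℝ)).smul_const u
  have h3 : HasFDerivAt Φ (fderiv ℝ Φ u) ((1 : ℝ) • u) := by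
    rw [one_smul]; exact (hd u).hasFDerivAt
  have h4 := h3.comp_hasDerivAt (1 : ℝ) h2
  simpa using h4.unique h1

/-- When `A u = B u` the second derivative of the fibering map reduces to `(q - r) * A u`. -/
lemma mem_nehariPlus (hq : 0 < q) (hqr : q < r) (hA : PosHomogeneous q A)
    (hB : PosHomogeneous r B) (hΦ : ∀ u, Φ u = 1 / q * A u - 1 / r * B u)
    (hd : Differentiable ℝ Φ) {u : X} (hAB : A u = B u) (hneg : A u < 0) :
    u ∈ nehariPlus Φ := by
  have hr : 0 < r := hq.trans hqr
  refine ⟨⟨?_, ?_⟩, ?_⟩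
  · rintro rfl
    rw [eq_zero_of_posHomogeneous hq hA] at hneg
    exact lt_irrefl _ hneg
  · rw [fderiv_apply_self hq.ne' hr.ne' hA hB hΦ hd, hAB, sub_self]
  · rw [iteratedDeriv_two_fibering hq.ne' hr.ne' hA hB hΦ, ← hAB]
    nlinarith

/-- At a critical point `Φ = (1/q - 1/r) A`, so negative energy forces `A < 0`. -/
lemma mem_nehariPlus_of_critical (hq : 0 < q) (hqr : q < r) (hA : PosHomogeneous q A)
    (hB : PosHomogeneous r B) (hΦ : ∀ u, Φ u = 1 / q * A u - 1 / r * B u)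
    (hd : Differentiable ℝ Φ) {u : X} (hcrit : fderiv ℝ Φ u = 0) (hneg : Φ u < 0) :
    u ∈ nehariPlus Φ := by
  have hr : 0 < r := hq.trans hqr
  have h1 := fderiv_apply_self hq.ne' hr.ne' hA hB hΦ hd u
  rw [hcrit] at h1
  have hAB : A u = B u := by
    have : (0 : ℝ) = A u - B u := h1
    linarith
  refine mem_nehariPlus hq hqr hA hB hΦ hd hAB ?_
  rw [hΦ, ← hAB, ← sub_mul] at hneg
  have h2 : 0 < 1 / q - 1 / r := sub_pos.2 (one_div_lt_one_div_of_lt hq hqr)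
  by_contra! h
  have := mul_nonneg h2.le h
  linarith

lemma nehariScale_rpow (hqr : q < r) (hB : PosHomogeneous r B) {u : X} (hAu : A u < 0)
    (hBu : B u < 0) : B (nehariScale q r A B u • u) = nehariScale q r A B u ^ q * A u := by
  have ht := nehariScale_pos (q := q) (r := r) hAu hBu
  have h1 : nehariScale q r A B u ^ (r - q) = A u / B u := by
    rw [nehariScale, ← Real.rpow_mul (div_pos_of_neg_of_neg hAu hBu).le,
      one_div_mul_cancel (sub_pos.2 hqr).ne', Real.rpow_one]
  rw [hB _ ht]
  have h2 : nehariScale q r A B u ^ r = nehariScale q r A B u ^ q * (A u / B u) := by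
    rw [← h1, ← Real.rpow_add ht]; congr 1; ring
  rw [h2]
  field_simp [hBu.ne]

lemma nehariScale_smul_mem (hq : 0 < q) (hqr : q < r) (hA : PosHomogeneous q A)
    (hB : PosHomogeneous r B) (hΦ : ∀ u, Φ u = 1 / q * A u - 1 / r * B u)
    (hd : Differentiable ℝ Φ) {u : X} (hAu : A u < 0) (hBu : B u < 0) :
    nehariScale q r A B u • u ∈ nehariPlus Φ ∧
      Φ (nehariScale q r A B u • u) = (1 / q - 1 / r) * (nehariScale q r A B u ^ q * A u) := by
  have ht := nehariScale_pos (q := q) (r := r) hAu hBu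
  have h1 := nehariScale_rpow hqr hB hAu hBu
  refine ⟨mem_nehariPlus hq hqr hA hB hΦ hd ?_ ?_, ?_⟩
  · rw [h1, hA _ ht]
  · rw [hA _ ht]
    exact mul_neg_of_pos_of_neg (Real.rpow_pos_of_pos ht _) hAu
  · rw [hΦ, h1, hA _ ht, sub_mul]

/-- For `B u < 0` the quotient `Φ (t • u) / t ^ q` is increasing in `t`, so negativity propagates
towards the origin. -/
lemma fibering_neg_of_le (hqr : q < r) (hr : 0 < r) (hA : PosHomogeneous q A)
    (hB : PosHomogeneous r B) (hΦ : ∀ u, Φ u = 1 / q * A u - 1 / r * B u)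
    {u : X} (hBu : B u < 0) {s t : ℝ} (hs : 0 < s) (hst : s ≤ t) (ht : Φ (t • u) < 0) :
    Φ (s • u) < 0 := by
  have ht0 := hs.trans_le hst
  have key : ∀ t : ℝ, 0 < t →
      Φ (t • u) = t ^ q * (1 / q * A u - 1 / r * (t ^ (r - q) * B u)) := by
    intro t ht
    rw [fibering_apply hA hB hΦ ht]
    have : t ^ r = t ^ q * t ^ (r - q) := by rw [← Real.rpow_add ht]; congr 1; ring
    rw [this]; ring
  rw [key t ht0] at ht
  rw [key s hs]
  have h1 := neg_of_mul_neg_right ht (Real.rpow_pos_of_pos ht0 q).le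
  have h2 : s ^ (r - q) ≤ t ^ (r - q) := Real.rpow_le_rpow hs.le hst (sub_pos.2 hqr).le
  have h3 : t ^ (r - q) * B u ≤ s ^ (r - q) * B u := mul_le_mul_of_nonpos_right h2 hBu.le
  have h4 := mul_le_mul_of_nonneg_left h3 (one_div_pos.2 hr).le
  exact mul_neg_of_pos_of_neg (Real.rpow_pos_of_pos hs q) (by linarith)

lemma joinedIn_ray {u : X} {s t : ℝ} (hs : 0 < s) (ht : 0 < t)
    (hmono : ∀ x y : ℝ, 0 < x → x ≤ y → Φ (y • u) < 0 → Φ (x • u) < 0)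
    (hΦs : Φ (s • u) < 0) (hΦt : Φ (t • u) < 0) : JoinedIn {x | Φ x < 0} (s • u) (t • u) := by
  refine JoinedIn.ofLine (f := fun σ : ℝ => ((1 - σ) * s + σ * t) • u) (by fun_prop) (by simp)
    (by simp) ?_
  rintro _ ⟨σ, ⟨h0, h1⟩, rfl⟩
  have hpos : 0 < (1 - σ) * s + σ * t := by
    rcases h0.eq_or_lt with rfl | h0
    · simpa using hs
    · have := mul_pos h0 ht
      have := mul_nonneg (sub_nonneg.2 h1) hs.le
      linarith
  rcases le_total s t with h | h
  · exact hmono _ t hpos (by nlinarith) hΦt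
  · exact hmono _ s hpos (by nlinarith) hΦs

/-- Following a path of directions along which `A < 0` and `B` increases to zero from below, one
finds points of the positive Nehari set with arbitrarily low energy, and reaches them inside
`{Φ < 0}`. -/
theorem exists_low_mem_nehariPlus (hq : 0 < q) (hqr : q < r) (hA : PosHomogeneous q A)
    (hB : PosHomogeneous r B) (hAc : Continuous A) (hBc : Continuous B)
    (hΦ : ∀ u, Φ u = 1 / q * A u - 1 / r * B u) (hd : Differentiable ℝ Φ) {b : ℝ → X}
    (hb : Continuous b) (hA0 : ∀ s ∈ Set.Icc (0 : ℝ) 1, A (b s) < 0)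
    (hB1 : ∀ s ∈ Set.Ioc (0 : ℝ) 1, B (b s) < 0) (hB0 : B (b 0) = 0) {τ : ℝ} (hτ : 0 < τ)
    (hz : Φ (τ • b 1) < 0) (R : ℝ) :
    ∃ v ∈ nehariPlus Φ, Φ v < R ∧ JoinedIn {x | Φ x < 0} (τ • b 1) v := by
  have hr : 0 < r := hq.trans hqr
  have hqr' : 0 < 1 / q - 1 / r := sub_pos.2 (one_div_lt_one_div_of_lt hq hqr)
  let t : ℝ → ℝ := fun s => nehariScale q r A B (b s)
  have ht : ∀ s ∈ Set.Ioc (0 : ℝ) 1, 0 < t s := fun s hs =>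
    nehariScale_pos (hA0 s ⟨hs.1.le, hs.2⟩) (hB1 s hs)
  have hneh : ∀ s ∈ Set.Ioc (0 : ℝ) 1, t s • b s ∈ nehariPlus Φ ∧
      Φ (t s • b s) = (1 / q - 1 / r) * (t s ^ q * A (b s)) := fun s hs =>
    nehariScale_smul_mem hq hqr hA hB hΦ hd (hA0 s ⟨hs.1.le, hs.2⟩) (hB1 s hs)
  have hneg : ∀ s ∈ Set.Ioc (0 : ℝ) 1, Φ (t s • b s) < 0 := by
    intro s hs
    rw [(hneh s hs).2]
    exact mul_neg_of_pos_of_neg hqr'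
      (mul_neg_of_pos_of_neg (Real.rpow_pos_of_pos (ht s hs) _) (hA0 s ⟨hs.1.le, hs.2⟩))
  have hIoc : ∀ᶠ s in 𝓝[>] (0 : ℝ), s ∈ Set.Ioc (0 : ℝ) 1 := Ioc_mem_nhdsGT one_pos
  have hAb : Continuous fun s => A (b s) := hAc.comp hb
  have hBb : Continuous fun s => B (b s) := hBc.comp hb
  have hAt : Tendsto (fun s => A (b s)) (𝓝[>] 0) (𝓝 (A (b 0))) :=
    hAb.continuousAt.tendsto.mono_left nhdsWithin_le_nhds
  have hBt : Tendsto (fun s => B (b s)) (𝓝[>] 0) (𝓝 0) := by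
    have := hBb.continuousAt (x := 0) |>.tendsto.mono_left (nhdsWithin_le_nhds (s := Set.Ioi 0))
    rwa [hB0] at this
  have hA00 := hA0 0 ⟨le_rfl, zero_le_one⟩
  -- As `A / B → +∞`, the Nehari scale `t s` blows up, and the energy `(1/q - 1/r) t^q A` tends to
  -- `-∞` because `A` keeps a negative limit.
  have h1 : Tendsto (fun s => A (b s) / B (b s)) (𝓝[>] 0) atTop := by
    have h2 : Tendsto (fun s => B (b s) / A (b s)) (𝓝[>] 0) (𝓝[>] 0) := by
      refine tendsto_nhdsWithin_iff.2 ⟨?_, ?_⟩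
      · have h3 := hBt.div hAt hA00.ne
        rwa [zero_div] at h3
      · filter_upwards [hIoc] with s hs
        exact div_pos_of_neg_of_neg (hB1 s hs) (hA0 s ⟨hs.1.le, hs.2⟩)
    have h3 := tendsto_inv_nhdsGT_zero.comp h2
    refine h3.congr fun s => ?_
    simp
  have h4 : Tendsto (fun s => t s ^ q) (𝓝[>] 0) atTop :=
    (tendsto_rpow_atTop hq).comp
      ((tendsto_rpow_atTop (one_div_pos.2 (sub_pos.2 hqr))).comp h1)
  have h5 : Tendsto (fun s => (1 / q - 1 / r) * (t s ^ q * A (b s))) (𝓝[>] 0) atBot :=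
    (h4.atTop_mul_neg hA00 hAt).const_mul_atBot hqr'
  obtain ⟨s, hsR, hs⟩ := ((h5.eventually_lt_atBot R).and hIoc).exists
  have h11 : (1 : ℝ) ∈ Set.Ioc (0 : ℝ) 1 := ⟨one_pos, le_rfl⟩
  refine ⟨t s • b s, (hneh s hs).1, by rwa [(hneh s hs).2], ?_⟩
  -- The connecting path first follows the ray of `b 1` to its Nehari point, then the curve of
  -- Nehari points `t s • b s`.
  have hray : JoinedIn {x | Φ x < 0} (τ • b 1) (t 1 • b 1) :=
    joinedIn_ray hτ (ht 1 h11)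
      (fun x y hx hxy hy => fibering_neg_of_le hqr hr hA hB hΦ (hB1 1 h11) hx hxy hy)
      hz (hneg 1 h11)
  refine hray.trans ?_
  have hmem : ∀ σ ∈ Set.Icc (0 : ℝ) 1, (1 - σ) + σ * s ∈ Set.Ioc (0 : ℝ) 1 := by
    rintro σ ⟨h0, h1⟩
    have := hs.1
    have := hs.2
    constructor
    · rcases h0.eq_or_lt with rfl | h0
      · simp
      · have := mul_pos h0 hs.1
        linarith
    · nlinarith
  have htc : ContinuousOn t (Set.Ioc (0 : ℝ) 1) := by
    refine ContinuousOn.rpow_const (hAb.continuousOn.div hBb.continuousOn fun s hs => (hB1 s hs).ne)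
      fun s hs => Or.inl ?_
    exact (div_pos_of_neg_of_neg (hA0 s ⟨hs.1.le, hs.2⟩) (hB1 s hs)).ne'
  have hlc : ContinuousOn (fun s => t s • b s) (Set.Ioc (0 : ℝ) 1) := htc.smul hb.continuousOn
  refine JoinedIn.ofLine (f := fun σ : ℝ => t ((1 - σ) + σ * s) • b ((1 - σ) + σ * s))
    (hlc.comp (f := fun σ : ℝ => (1 - σ) + σ * s) (by fun_prop) hmem) (by simp) (by simp) ?_
  rintro _ ⟨σ, hσ, rfl⟩
  exact hneg _ (hmem σ hσ)

end Fibering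

/-! ### Elementary real-variable estimates -/

/-- A lower order power is controlled by a higher order one. -/
lemma exists_bound_of_rpow_sub_le {p γ : ℝ} (hp : 0 < p) (hpγ : p < γ) (a : ℝ) {b : ℝ}
    (hb : 0 < b) (R : ℝ) :
    ∃ M, 0 < M ∧ ∀ x, 0 < x → b * x ^ γ - a * x ^ p ≤ R → x ≤ M := by
  -- Beyond `y` the bracket in `x^p (b x^(γ-p) - a)` is at least `|R| + 1`; the maximum with `1`
  -- ensures `x^p ≥ 1`.
  set y := ((|a| + |R| + 1) / b) ^ (1 / (γ - p)) with hy
  have hd : 0 < γ - p := sub_pos.2 hpγ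
  have hpos : 0 < (|a| + |R| + 1) / b := by positivity
  refine ⟨max 1 y, by positivity, fun x hx h => ?_⟩
  by_contra! hlt
  obtain ⟨h1, h2⟩ := max_lt_iff.1 hlt
  have h3 : (|a| + |R| + 1) / b < x ^ (γ - p) := by
    have := Real.rpow_lt_rpow (by positivity) h2 hd
    rwa [hy, ← Real.rpow_mul hpos.le, one_div_mul_cancel hd.ne', Real.rpow_one] at this
  rw [div_lt_iff₀ hb] at h3
  have h4 : 1 ≤ x ^ p := Real.one_le_rpow h1.le hp.le
  have h5 : x ^ γ = x ^ p * x ^ (γ - p) := by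
    rw [← Real.rpow_add hx]; congr 1; ring
  have h6 : |R| + 1 ≤ x ^ (γ - p) * b - a := by linarith [le_abs_self a]
  have h7 : b * x ^ γ - a * x ^ p = x ^ p * (x ^ (γ - p) * b - a) := by rw [h5]; ring
  rw [h7] at h
  have h8 : |R| + 1 ≤ x ^ p * (x ^ (γ - p) * b - a) := by
    nlinarith [abs_nonneg R]
  linarith [le_abs_self R]

/-- Supplies the constant `D` in the energy bound on the boundary of the wells. -/
lemma exists_rpow_sub_le {p γ : ℝ} (hp : 0 < p) (hpγ : p < γ) {a b : ℝ} (ha : 0 ≤ a)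
    (hb : 0 < b) : ∃ D, 0 < D ∧ ∀ x, 0 < x → a * x ^ p - b * x ^ γ ≤ D := by
  obtain ⟨M, hM, h⟩ := exists_bound_of_rpow_sub_le hp hpγ a hb 0
  refine ⟨a * M ^ p + 1, by positivity, fun x hx => ?_⟩
  rcases le_total (b * x ^ γ - a * x ^ p) 0 with h1 | h1
  · have h2 : x ^ p ≤ M ^ p := Real.rpow_le_rpow hx.le (h x hx h1) hp.le
    have h3 : 0 ≤ b * x ^ γ := by positivity
    have := mul_le_mul_of_nonneg_left h2 ha
    linarith
  · have : 0 ≤ a * M ^ p := by positivity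
    linarith

lemma exists_last_zero {f : ℝ → ℝ} (hf : Continuous f) (h0 : f 0 < 0) (h1 : 0 < f 1) :
    ∃ s ∈ Set.Ioo (0 : ℝ) 1, f s = 0 ∧ ∀ t ∈ Set.Ioc s 1, 0 < f t := by
  have hc : IsCompact (Set.Icc (0 : ℝ) 1 ∩ {s | f s ≤ 0}) :=
    isCompact_Icc.inter_right (isClosed_le hf continuous_const)
  obtain ⟨s, ⟨⟨hs0, hs1⟩, hs⟩, hmax⟩ := hc.exists_isGreatest ⟨0, ⟨le_rfl, zero_le_one⟩, h0.le⟩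
  have hs' : f s ≤ 0 := hs
  have hlt : s < 1 := lt_of_le_of_ne hs1 (by rintro rfl; linarith)
  have hpos : ∀ t ∈ Set.Ioc s 1, 0 < f t := by
    intro t ht
    by_contra! h
    exact ht.1.not_ge (hmax ⟨⟨hs0.trans ht.1.le, ht.2⟩, h⟩)
  have hzero : f s = 0 := by
    refine le_antisymm hs' ?_
    refine ge_of_tendsto (hf.continuousAt.tendsto.mono_left (nhdsWithin_le_nhds (s := Set.Ioi s))) ?_
    filter_upwards [Ioc_mem_nhdsGT hlt] with t ht using (hpos t ht).le
  refine ⟨s, ⟨lt_of_le_of_ne hs0 ?_, hlt⟩, hzero, hpos⟩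
  rintro rfl
  linarith

/-! ### Calculus of weak semicontinuity -/

section WeakSemicontinuity

variable {X : Type*} [NormedAddCommGroup X] [NormedSpace ℝ X] {G₁ G₂ : X → ℝ}

lemma Nehari.WeaklyLSC.add (h₁ : WeaklyLSC G₁) (h₂ : WeaklyLSC G₂) :
    WeaklyLSC fun u => G₁ u + G₂ u := by
  intro w a hw c hc
  filter_upwards [h₁ w a hw (G₁ a - (G₁ a + G₂ a - c) / 2) (by linarith),
    h₂ w a hw (G₂ a - (G₁ a + G₂ a - c) / 2) (by linarith)] with n h3 h4
  linarith

lemma Nehari.WeaklyLSC.const_mul (h : WeaklyLSC G₁) {k : ℝ} (hk : 0 < k) :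
    WeaklyLSC fun u => k * G₁ u := by
  intro w a hw c hc
  filter_upwards [h w a hw (c / k) (by rwa [div_lt_iff₀' hk])] with n hn
  rwa [div_lt_iff₀' hk] at hn

lemma Nehari.WeaklyUSC.neg (h : WeaklyUSC G₁) : WeaklyLSC fun u => -G₁ u := by
  intro w a hw c hc
  filter_upwards [h w a hw (-c) (by linarith)] with n hn
  linarith

lemma Nehari.WeaklyContinuous.const_mul_lsc (h : WeaklyContinuous G₁) (k : ℝ) :
    WeaklyLSC fun u => k * G₁ u := fun w a hw _ hc =>
  ((h w a hw).const_mul k).eventually_const_lt hc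

lemma Nehari.WeaklyLSC.rpow_const (h : WeaklyLSC G₁) (h0 : ∀ u, 0 ≤ G₁ u) {s : ℝ} (hs : 0 < s) :
    WeaklyLSC fun u => G₁ u ^ s := by
  intro w a hw c hc
  rcases lt_or_ge c 0 with hc0 | hc0
  · exact Eventually.of_forall fun n => hc0.trans_le (Real.rpow_nonneg (h0 _) _)
  · have h1 : c ^ (1 / s) < G₁ a := by
      have := Real.rpow_lt_rpow hc0 hc (one_div_pos.2 hs)
      rwa [← Real.rpow_mul (h0 a), mul_one_div_cancel hs.ne', Real.rpow_one] at this
    filter_upwards [h w a hw _ h1] with n hn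
    have := Real.rpow_lt_rpow (by positivity) hn hs
    rwa [← Real.rpow_mul hc0, one_div_mul_cancel hs.ne', Real.rpow_one] at this

end WeakSemicontinuity

/-! ### Local comparison near a constrained minimizer -/

section LocalStructure

variable {X : Type*} [NormedAddCommGroup X] [NormedSpace ℝ X]

/-- Increments of a strictly differentiable function in a direction of increase. -/
lemma eventually_increment_bounds {f : X → ℝ} {f' : StrongDual ℝ X} {a w : X}
    (hf : HasStrictFDerivAt f f' a) (hw : 0 < f' w) :
    ∀ᶠ z : X × ℝ in 𝓝 (a, 0), 0 ≤ z.2 →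
      z.2 * (f' w / 2) ≤ f (z.1 + z.2 • w) - f z.1 ∧
      f (z.1 + z.2 • w) - f z.1 ≤ z.2 * (2 * f' w) := by
  have hlo := hasStrictFDerivAt_iff_isLittleO.mp hf
  have hw0 : 0 < ‖w‖ := norm_pos_iff.2 (by rintro rfl; simp at hw)
  have h1 := hlo.def (c := f' w / (2 * ‖w‖)) (by positivity)
  have hc : Tendsto (fun z : X × ℝ => (z.1 + z.2 • w, z.1)) (𝓝 (a, 0)) (𝓝 (a, a)) := by
    have : Continuous fun z : X × ℝ => (z.1 + z.2 • w, z.1) := by fun_prop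
    simpa using this.tendsto (a, 0)
  filter_upwards [hc.eventually h1] with z hz h0
  simp only [add_sub_cancel_left, map_smul, smul_eq_mul, norm_smul, Real.norm_eq_abs,
    abs_of_nonneg h0] at hz
  have h2 : f' w / (2 * ‖w‖) * (z.2 * ‖w‖) = z.2 * (f' w / 2) := by field_simp
  rw [h2, abs_le] at hz
  have h3 : 0 ≤ z.2 * f' w := by positivity
  constructor <;> linarith [hz.1, hz.2]

/-- If `h ≥ 0` on `{F ≥ 0}` and both increase in a common direction at a zero `a` of `F`, then
near `a` the functions `F` and `h` control each other. -/
lemma eventually_comparable {F h : X → ℝ} {F' h' : StrongDual ℝ X} {a w : X}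
    (hF : HasStrictFDerivAt F F' a) (hh : HasStrictFDerivAt h h' a) (hFa : F a = 0)
    (hFw : 0 < F' w) (hhw : 0 < h' w) (hFh : ∀ x, 0 ≤ F x → 0 ≤ h x) :
    ∃ C, ∀ᶠ v in 𝓝 a, (F v < 0 → -h v ≤ C * -F v) ∧ (0 ≤ F v → F v ≤ C * h v) := by
  have hFt : Tendsto F (𝓝 a) (𝓝 0) := by
    have := hF.continuousAt.tendsto
    rwa [hFa] at this
  have e1 := eventually_increment_bounds hF hFw
  have e2 := eventually_increment_bounds hh hhw
  -- If `F v < 0`, a step of this length along `w` reaches `{F ≥ 0}`, where `h ≥ 0`, so `-h v` is at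
  -- most the gain of `h`. If `F v ≥ 0`, the backward step in `t2` stays in `{F ≥ 0}`, so `h v` is
  -- at least the gain of `h` on the way back.
  have t1 : Tendsto (fun v => (v, -F v / (F' w / 2))) (𝓝 a) (𝓝 (a, 0)) := by
    refine Tendsto.prodMk_nhds tendsto_id ?_
    simpa using hFt.neg.div_const (F' w / 2)
  have t2 : Tendsto (fun v => (v - (F v / (2 * F' w)) • w, F v / (2 * F' w))) (𝓝 a)
      (𝓝 (a, 0)) := by
    have h3 : Tendsto (fun v => F v / (2 * F' w)) (𝓝 a) (𝓝 0) := by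
      simpa using hFt.div_const (2 * F' w)
    refine Tendsto.prodMk_nhds ?_ h3
    simpa using tendsto_id.sub (h3.smul_const w)
  refine ⟨max (2 * h' w / (F' w / 2)) (2 * F' w / (h' w / 2)), ?_⟩
  filter_upwards [t1.eventually e1, t1.eventually e2, t2.eventually e1, t2.eventually e2]
    with v a1 a2 a3 a4
  constructor
  · intro hv
    have hs : 0 ≤ -F v / (F' w / 2) := div_nonneg (by linarith) (by linarith)
    have b1 := (a1 hs).1
    have b2 := (a2 hs).2
    rw [div_mul_cancel₀ _ (by linarith)] at b1
    have b3 := hFh (v + (-F v / (F' w / 2)) • w) (by linarith)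
    have b4 : -h v ≤ -F v / (F' w / 2) * (2 * h' w) := by linarith
    have b5 : -F v / (F' w / 2) * (2 * h' w) = 2 * h' w / (F' w / 2) * -F v := by ring
    rw [b5] at b4
    exact b4.trans (mul_le_mul_of_nonneg_right (le_max_left _ _) (by linarith))
  · intro hv
    have hs : 0 ≤ F v / (2 * F' w) := div_nonneg hv (by linarith)
    have b1 := (a3 hs).2
    have b2 := (a4 hs).1
    simp only [sub_add_cancel] at b1 b2
    rw [div_mul_cancel₀ _ (by linarith)] at b1
    have b3 := hFh (v - (F v / (2 * F' w)) • w) (by linarith)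
    have b4 : F v / (2 * F' w) * (h' w / 2) ≤ h v := by linarith
    have b5 : F v = 2 * F' w / (h' w / 2) * (F v / (2 * F' w) * (h' w / 2)) := by
      field_simp
    have b6 : 0 ≤ h v := hFh v hv
    calc F v = 2 * F' w / (h' w / 2) * (F v / (2 * F' w) * (h' w / 2)) := b5
      _ ≤ 2 * F' w / (h' w / 2) * h v := mul_le_mul_of_nonneg_left b4 (by positivity)
      _ ≤ _ := mul_le_mul_of_nonneg_right (le_max_right _ _) b6

/-- At a zero of `h` minimizing `h` over `{F ≥ 0}` and with nonvanishing derivatives, there is a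
common direction of increase. -/
lemma exists_common_increasing_direction {F h : X → ℝ} {F' h' : StrongDual ℝ X} {a : X}
    (hF : HasStrictFDerivAt F F' a) (hh : HasStrictFDerivAt h h' a) (hFa : F a = 0)
    (hha : h a = 0) (hF0 : F' ≠ 0) (hh0 : h' ≠ 0) (hFh : ∀ x, 0 ≤ F x → 0 ≤ h x) :
    ∃ w, 0 < F' w ∧ 0 < h' w := by
  have hex : ∀ f : StrongDual ℝ X, f ≠ 0 → ∃ w, 0 < f w := by
    intro f hf
    obtain ⟨w, hw⟩ := DFunLike.ne_iff.1 hf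
    rcases lt_or_gt_of_ne hw with h | h
    · exact ⟨-w, by rw [map_neg]; simpa using h⟩
    · exact ⟨w, by simpa using h⟩
  have hline : Tendsto (fun s : ℝ => (a, s)) (𝓝[>] 0) (𝓝 (a, (0 : ℝ))) :=
    tendsto_const_nhds.prodMk_nhds nhdsWithin_le_nhds
  -- If `F` increased and `h` decreased along `w`, a small step from `a` would give `F ≥ 0` and `h <
  -- 0`.
  have key : ∀ w, 0 < F' w → 0 ≤ h' w := by
    intro w hw
    by_contra! hneg
    have e1 := hline.eventually (eventually_increment_bounds hF hw)
    have hn : HasStrictFDerivAt (fun x => -h x) (-h') a := hh.neg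
    have e2 := hline.eventually (eventually_increment_bounds hn (w := w) (by simpa using hneg))
    obtain ⟨s, ⟨h1, h2⟩, hs⟩ := ((e1.and e2).and self_mem_nhdsWithin).exists
    have hs' : 0 < s := hs
    have h3 := (h1 hs'.le).1
    have h4 := (h2 hs'.le).1
    simp only [hFa, hha, neg_apply] at h3 h4
    have h5 := hFh (a + s • w) (by nlinarith)
    nlinarith
  obtain ⟨w, hw⟩ := hex F' hF0
  obtain ⟨w', hw'⟩ := hex h' hh0
  -- Small enough that adding `τ • w'`, which makes `h'` strictly positive, costs at most half of
  -- `F' w`.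
  set τ := F' w / (2 * (|F' w'| + 1)) with hτ
  have hτ0 : 0 < τ := by positivity
  have h1 : τ * |F' w'| ≤ F' w / 2 := by
    rw [hτ, div_mul_eq_mul_div, div_le_div_iff₀ (by positivity) two_pos]
    nlinarith [abs_nonneg (F' w')]
  refine ⟨w + τ • w', ?_, ?_⟩
  · rw [map_add, map_smul, smul_eq_mul]
    have := mul_le_mul_of_nonneg_left (neg_abs_le (F' w')) hτ0.le
    linarith
  · rw [map_add, map_smul, smul_eq_mul]
    have := key w hw
    positivity

end LocalStructure

/-! ### Minimizers for the threshold and the global comparison -/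

namespace Nehari

section Threshold

variable {X : Type*} [NormedAddCommGroup X] [NormedSpace ℝ X] {p γ : ℝ} {P₁ P₂ F : X → ℝ}

lemma BasicConditions.p_pos (hb : BasicConditions p γ P₁ P₂ F) : 0 < p :=
  one_pos.trans hb.one_lt_p

lemma BasicConditions.γ_pos (hb : BasicConditions p γ P₁ P₂ F) : 0 < γ :=
  one_pos.trans hb.one_lt_γ

lemma BasicConditions.P₁_zero (hb : BasicConditions p γ P₁ P₂ F) : P₁ 0 = 0 :=
  eq_zero_of_posHomogeneous hb.p_pos hb.hom_P₁

lemma BasicConditions.P₂_zero (hb : BasicConditions p γ P₁ P₂ F) : P₂ 0 = 0 :=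
  eq_zero_of_posHomogeneous hb.p_pos hb.hom_P₂

lemma BasicConditions.P₁_pos (hb : BasicConditions p γ P₁ P₂ F) {u : X} (hu : u ≠ 0) :
    0 < P₁ u := by
  obtain ⟨C, hC, h⟩ := hb.le_P₁
  have : 0 < ‖u‖ := norm_pos_iff.2 hu
  exact lt_of_lt_of_le (by positivity) (h u)

lemma BasicConditions.P₁_nonneg (hb : BasicConditions p γ P₁ P₂ F) (u : X) : 0 ≤ P₁ u := by
  by_cases hu : u = 0
  · rw [hu, hb.P₁_zero]
  · exact (hb.P₁_pos hu).le

lemma BasicConditions.P₂_nonneg' (hb : BasicConditions p γ P₁ P₂ F) (u : X) : 0 ≤ P₂ u := by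
  by_cases hu : u = 0
  · rw [hu, hb.P₂_zero]
  · exact hb.P₂_nonneg u hu

lemma BasicConditions.exists_normalized (hb : BasicConditions p γ P₁ P₂ F) {u : X} (hu : u ≠ 0) :
    ∃ (x : ℝ) (v : X), 0 < x ∧ P₁ v = 1 ∧ u = x • v := by
  have h1 := hb.P₁_pos hu
  have hx : 0 < P₁ u ^ (1 / p) := Real.rpow_pos_of_pos h1 _
  refine ⟨P₁ u ^ (1 / p), (P₁ u ^ (1 / p))⁻¹ • u, hx, ?_, ?_⟩
  · rw [hb.hom_P₁ _ (inv_pos.2 hx), Real.inv_rpow hx.le, ← Real.rpow_mul h1.le,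
      one_div_mul_cancel hb.p_pos.ne', Real.rpow_one, inv_mul_cancel₀ h1.ne']
  · rw [smul_inv_smul₀ hx.ne']

lemma BasicConditions.ne_zero_of_P₁_eq_one (hb : BasicConditions p γ P₁ P₂ F) {v : X}
    (hv : P₁ v = 1) : v ≠ 0 := by
  rintro rfl
  rw [hb.P₁_zero] at hv
  exact zero_ne_one hv

lemma BasicConditions.exists_norm_le (hb : BasicConditions p γ P₁ P₂ F) (M : ℝ) :
    ∃ ρ, 0 ≤ ρ ∧ ∀ u, P₁ u ≤ M → ‖u‖ ≤ ρ := by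
  obtain ⟨C, hC, h⟩ := hb.le_P₁
  refine ⟨(max M 0 / C) ^ (1 / p), by positivity, fun u hu => ?_⟩
  have h1 : ‖u‖ ^ p ≤ max M 0 / C := by
    rw [le_div_iff₀' hC]
    exact (h u).trans (hu.trans (le_max_left _ _))
  have h2 := Real.rpow_le_rpow (by positivity) h1 (one_div_pos.2 hb.p_pos).le
  rwa [← Real.rpow_mul (norm_nonneg u), mul_one_div_cancel hb.p_pos.ne', Real.rpow_one] at h2

lemma BasicConditions.exists_P₂_le (hb : BasicConditions p γ P₁ P₂ F) :
    ∃ K, 0 < K ∧ ∀ u, P₂ u ≤ K * P₁ u := by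
  obtain ⟨C, hC, h⟩ := hb.le_P₁
  obtain ⟨D, hD, h'⟩ := hb.P₂_le
  refine ⟨D / C, by positivity, fun u => (h' u).trans ?_⟩
  have := mul_le_mul_of_nonneg_left (h u) (show 0 ≤ D / C by positivity)
  rwa [← mul_assoc, div_mul_cancel₀ _ hC.ne'] at this

lemma BasicConditions.exists_F_le (hb : BasicConditions p γ P₁ P₂ F) :
    ∃ K, 0 < K ∧ ∀ u, P₁ u = 1 → F u ≤ K := by
  obtain ⟨C, hC, h⟩ := hb.F_le
  obtain ⟨ρ, hρ, h'⟩ := hb.exists_norm_le 1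
  refine ⟨C * ρ ^ γ + 1, by positivity, fun u hu => (h u).trans ?_⟩
  have h1 := Real.rpow_le_rpow (norm_nonneg u) (h' u hu.le) hb.γ_pos.le
  have := mul_le_mul_of_nonneg_left h1 hC.le
  linarith

lemma BasicConditions.H_smul (hb : BasicConditions p γ P₁ P₂ F) (lam : ℝ) :
    PosHomogeneous p (H P₁ P₂ lam) := by
  intro t ht u
  rw [H, H, hb.hom_P₁ t ht, hb.hom_P₂ t ht]
  ring

lemma BasicConditions.contDiff_H (hb : BasicConditions p γ P₁ P₂ F) (lam : ℝ) :
    ContDiff ℝ 1 (H P₁ P₂ lam) :=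
  hb.contDiff_P₁.sub (contDiff_const.mul hb.contDiff_P₂)

lemma mul_le_of_le_quot (hb : BasicConditions p γ P₁ P₂ F) {l : ℝ} {u : X}
    (h : (l : EReal) ≤ quot P₁ P₂ u) : l * P₂ u ≤ P₁ u := by
  rw [quot] at h
  split_ifs at h with h0
  · rw [h0, mul_zero]; exact hb.P₁_nonneg u
  · have h1 : 0 < P₂ u := lt_of_le_of_ne (hb.P₂_nonneg' u) (Ne.symm h0)
    exact (le_div_iff₀ h1).1 (EReal.coe_le_coe_iff.1 h)

lemma lt_mul_of_quot_lt (hb : BasicConditions p γ P₁ P₂ F) {l : ℝ} {u : X}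
    (h : quot P₁ P₂ u < (l : EReal)) : P₁ u < l * P₂ u := by
  rw [quot] at h
  split_ifs at h with h0
  · exact absurd h (not_lt.2 le_top)
  · have h1 : 0 < P₂ u := lt_of_le_of_ne (hb.P₂_nonneg' u) (Ne.symm h0)
    exact (div_lt_iff₀ h1).1 (EReal.coe_lt_coe_iff.1 h)

/-- The bound `P₂ ≤ K P₁` keeps every quotient above `1 / K`. -/
lemma lambdaStar_pos (hb : BasicConditions p γ P₁ P₂ F) : 0 < lambdaStar P₁ P₂ F := by
  obtain ⟨K, hK, h⟩ := hb.exists_P₂_le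
  refine lt_of_lt_of_le (EReal.coe_pos.2 (inv_pos.2 hK)) (le_iInf₂ fun u _ => ?_)
  rw [quot]
  split_ifs with h0
  · exact le_top
  · have h1 : 0 < P₂ u := lt_of_le_of_ne (hb.P₂_nonneg' u) (Ne.symm h0)
    rw [EReal.coe_le_coe_iff, le_div_iff₀ h1, inv_mul_le_iff₀ hK]
    exact h u

lemma H_nonneg (hb : BasicConditions p γ P₁ P₂ F) (hH1 : CondH1 P₁ P₂ F) {l : ℝ}
    (hl : lambdaStar P₁ P₂ F = (l : EReal)) {u : X} (hu : 0 ≤ F u) : 0 ≤ H P₁ P₂ l u := by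
  by_cases h0 : u = 0
  · rw [H, h0, hb.P₁_zero, hb.P₂_zero]; simp
  · have h1 : (l : EReal) ≤ quot P₁ P₂ u := by
      rw [← hl, hH1]
      exact iInf₂_le u ⟨h0, hu⟩
    have := mul_le_of_le_quot hb h1
    rw [H]; linarith

lemma achievesLambdaStar (hb : BasicConditions p γ P₁ P₂ F) {l : ℝ}
    (hl : lambdaStar P₁ P₂ F = (l : EReal)) {a : X} (ha : a ≠ 0) (hFa : 0 ≤ F a)
    (hHa : H P₁ P₂ l a = 0) : AchievesLambdaStar P₁ P₂ F l a := by
  refine ⟨hl, ha, hFa, ?_⟩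
  have h1 := hb.P₁_pos ha
  have h2 : P₂ a ≠ 0 := by
    intro h0
    rw [H, h0] at hHa
    linarith
  rw [quot, if_neg h2, EReal.coe_eq_coe_iff, div_eq_iff h2]
  rw [H] at hHa
  linarith

/-- Almost minimizing sequences for `λ*` are strongly compact. -/
lemma exists_tendsto_minimizer (hX : IsReflexive X) (hb : BasicConditions p γ P₁ P₂ F)
    (hH1 : CondH1 P₁ P₂ F) (hS : CondS P₁) {l : ℝ} (hl : lambdaStar P₁ P₂ F = (l : EReal))
    {u : ℕ → X} (h1 : ∀ n, P₁ (u n) = 1) (hF : ∀ δ > 0, ∀ᶠ n in atTop, -δ < F (u n))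
    (hH : ∀ δ > 0, ∀ᶠ n in atTop, H P₁ P₂ l (u n) < δ) :
    ∃ (φ : ℕ → ℕ) (a : X), StrictMono φ ∧ Tendsto (fun n => u (φ n)) atTop (𝓝 a) ∧ a ≠ 0 ∧
      0 ≤ F a ∧ H P₁ P₂ l a = 0 := by
  obtain ⟨ρ, -, hρ⟩ := hb.exists_norm_le 1
  obtain ⟨φ, a, hφ, ha⟩ := exists_weakTendsto_subseq hX u ρ fun n => hρ _ (h1 n).le
  have hFa : 0 ≤ F a := by
    by_contra! hlt
    have e1 := hb.usc_F _ a ha (F a / 2) (by linarith)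
    have e2 := hφ.tendsto_atTop.eventually (hF (-F a / 2) (by linarith))
    obtain ⟨n, h3, h4⟩ := (e1.and e2).exists
    linarith
  have hP1 : P₁ a ≤ 1 := by
    by_contra! hlt
    obtain ⟨n, hn⟩ := (hb.lsc_P₁ _ a ha 1 hlt).exists
    rw [h1] at hn
    exact lt_irrefl _ hn
  have hP2 : 1 ≤ l * P₂ a := by
    refine le_of_forall_pos_le_add fun δ hδ => ?_
    refine ge_of_tendsto (((hb.cont_P₂ _ a ha).const_mul l).add_const δ) ?_
    filter_upwards [hφ.tendsto_atTop.eventually (hH δ hδ)] with n hn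
    rw [H, h1] at hn
    linarith
  -- Since `F a ≥ 0`, also `l * P₂ a ≤ P₁ a`. With `P₁ a ≤ 1 ≤ l * P₂ a` this forces `P₁ a = 1`:
  -- nothing is lost in the weak limit, and (S) applies.
  have hHa := H_nonneg hb hH1 hl hFa
  rw [H] at hHa
  have hPa : P₁ a = 1 := by linarith
  refine ⟨φ, a, hφ, hS _ a ha ?_, hb.ne_zero_of_P₁_eq_one hPa, hFa, by rw [H]; linarith⟩
  simp [h1, hPa]

/-- The infimum defining `λ*` is attained. -/
lemma exists_minimizer (hX : IsReflexive X) (hb : BasicConditions p γ P₁ P₂ F)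
    (hH1 : CondH1 P₁ P₂ F) (hS : CondS P₁) {l : ℝ} (hl : lambdaStar P₁ P₂ F = (l : EReal)) :
    ∃ a, a ≠ 0 ∧ 0 ≤ F a ∧ H P₁ P₂ l a = 0 := by
  obtain ⟨K, hK, hKP⟩ := hb.exists_P₂_le
  have hstep : ∀ n : ℕ, ∃ v, P₁ v = 1 ∧ F v = 0 ∧ H P₁ P₂ l v < 1 / ((n : ℝ) + 1) * K := by
    intro n
    have hs : 0 < 1 / ((n : ℝ) + 1) := by positivity
    have h1 : lambdaStar P₁ P₂ F < ((l + 1 / ((n : ℝ) + 1) : ℝ) : EReal) := by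
      rw [hl, EReal.coe_lt_coe_iff]; linarith
    obtain ⟨u, ⟨hu0, hFu⟩, hu⟩ : ∃ u, (u ≠ 0 ∧ F u = 0) ∧
        quot P₁ P₂ u < ((l + 1 / ((n : ℝ) + 1) : ℝ) : EReal) := by
      simpa [lambdaStar, iInf_lt_iff] using h1
    have h2 := lt_mul_of_quot_lt hb hu
    obtain ⟨x, v, hx, hv, rfl⟩ := hb.exists_normalized hu0
    have hxp : 0 < x ^ p := Real.rpow_pos_of_pos hx p
    have hxγ : 0 < x ^ γ := Real.rpow_pos_of_pos hx γ
    refine ⟨v, hv, ?_, ?_⟩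
    · rw [hb.hom_F x hx] at hFu
      exact (mul_eq_zero.1 hFu).resolve_left hxγ.ne'
    · rw [hb.hom_P₁ x hx, hb.hom_P₂ x hx, mul_left_comm] at h2
      have h3 := lt_of_mul_lt_mul_left h2 hxp.le
      have h4 := hKP v
      rw [hv, mul_one] at h4
      have := mul_le_mul_of_nonneg_left h4 hs.le
      rw [H]
      linarith
  choose v hv1 hv2 hv3 using hstep
  have ht : Tendsto (fun n : ℕ => 1 / ((n : ℝ) + 1) * K) atTop (𝓝 0) := by
    simpa using (tendsto_one_div_add_atTop_nhds_zero_nat (𝕜 := ℝ)).mul_const K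
  obtain ⟨φ, a, -, -, h⟩ := exists_tendsto_minimizer hX hb hH1 hS hl hv1
    (fun δ hδ => Eventually.of_forall fun n => by rw [hv2]; linarith)
    (fun δ hδ => by
      filter_upwards [ht.eventually_lt_const hδ] with n hn using (hv3 n).trans hn)
  exact ⟨a, h⟩

/-- A minimizer for `λ*` is a zero of `F`, and there `F` and `H_{λ*}` have a common direction of
increase. -/
lemma minimizer_structure (hb : BasicConditions p γ P₁ P₂ F) (hH1 : CondH1 P₁ P₂ F)
    (hC1 : CondC1 P₁ P₂ F) (hC2 : CondC2 P₁ P₂ F) {l : ℝ}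
    (hl : lambdaStar P₁ P₂ F = (l : EReal)) {a : X} (ha : a ≠ 0) (hFa : 0 ≤ F a)
    (hHa : H P₁ P₂ l a = 0) :
    F a = 0 ∧ ∃ w, 0 < fderiv ℝ F a w ∧ 0 < fderiv ℝ (H P₁ P₂ l) a w := by
  have hach := achievesLambdaStar hb hl ha hFa hHa
  -- If `F a > 0`, the constraint is inactive and `a` is a local minimum of `H_l`, against (C2).
  have hF0 : F a = 0 := by
    by_contra hne
    have hpos : 0 < F a := lt_of_le_of_ne hFa (Ne.symm hne)
    refine hC2 l a hach (IsLocalMin.fderiv_eq_zero ?_)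
    filter_upwards [(isOpen_lt continuous_const hb.contDiff_F.continuous).mem_nhds hpos] with x hx
    rw [hHa]
    exact H_nonneg hb hH1 hl (le_of_lt hx)
  exact ⟨hF0, exists_common_increasing_direction (hb.contDiff_F.hasStrictFDerivAt one_ne_zero)
    ((hb.contDiff_H l).hasStrictFDerivAt one_ne_zero) hF0 hHa (hC1 l a hach) (hC2 l a hach)
    fun x hx => H_nonneg hb hH1 hl hx⟩

/-- Global comparison of `F` and `H_{λ*}` on the set `{P₁ = 1}`. -/
lemma exists_comparison (hX : IsReflexive X) (hb : BasicConditions p γ P₁ P₂ F)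
    (hH1 : CondH1 P₁ P₂ F) (hS : CondS P₁) (hC1 : CondC1 P₁ P₂ F) (hC2 : CondC2 P₁ P₂ F) {l : ℝ}
    (hl : lambdaStar P₁ P₂ F = (l : EReal)) :
    ∃ C, 0 < C ∧ ∀ v, P₁ v = 1 → (F v < 0 → -H P₁ P₂ l v ≤ C * -F v) ∧
      (0 ≤ F v → F v ≤ C * H P₁ P₂ l v) := by
  obtain ⟨K, hK, hKP⟩ := hb.exists_P₂_le
  obtain ⟨K', hK', hKF⟩ := hb.exists_F_le
  have hlpos : 0 < l := EReal.coe_pos.1 (hl ▸ lambdaStar_pos hb)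
  -- Violations with constants `n + 1` form an almost minimizing sequence, because `F` is bounded
  -- above and `H_l` below on `{P₁ = 1}`. Its limit is a minimizer, near which the local comparison
  -- holds with a fixed constant.
  by_contra! hcon
  have hcon' : ∀ n : ℕ, ∃ v, P₁ v = 1 ∧
      ((F v < 0 → -H P₁ P₂ l v ≤ ((n : ℝ) + 1) * -F v) →
        0 ≤ F v ∧ ((n : ℝ) + 1) * H P₁ P₂ l v < F v) := fun n => hcon _ (by positivity)
  choose v hv1 hv2 using hcon'
  have hbad : ∀ n, (F (v n) < 0 ∧ ((n : ℝ) + 1) * -F (v n) < -H P₁ P₂ l (v n)) ∨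
      (0 ≤ F (v n) ∧ ((n : ℝ) + 1) * H P₁ P₂ l (v n) < F (v n)) := by
    intro n
    by_cases h : F (v n) < 0 → -H P₁ P₂ l (v n) ≤ ((n : ℝ) + 1) * -F (v n)
    · exact Or.inr (hv2 n h)
    · push Not at h
      exact Or.inl h
  have hlow : ∀ n, -H P₁ P₂ l (v n) ≤ l * K := by
    intro n
    have h1 := hKP (v n)
    rw [hv1, mul_one] at h1
    have := mul_le_mul_of_nonneg_left h1 hlpos.le
    rw [H, hv1]
    linarith
  have ht : ∀ k : ℝ, Tendsto (fun n : ℕ => 1 / ((n : ℝ) + 1) * k) atTop (𝓝 0) := fun k => by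
    simpa using (tendsto_one_div_add_atTop_nhds_zero_nat (𝕜 := ℝ)).mul_const k
  obtain ⟨φ, a, hφ, hta, ha0, hFa, hHa⟩ := exists_tendsto_minimizer hX hb hH1 hS hl hv1
    (fun δ hδ => by
      filter_upwards [(ht (l * K)).eventually_lt_const hδ] with n hn
      rcases hbad n with ⟨h1, h2⟩ | ⟨h1, -⟩
      · have hn0 : (0 : ℝ) < (n : ℝ) + 1 := by positivity
        rw [one_div, inv_mul_lt_iff₀ hn0] at hn
        have h3 : ((n : ℝ) + 1) * -F (v n) < ((n : ℝ) + 1) * δ := h2.trans_le ((hlow n).trans hn.le)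
        have := lt_of_mul_lt_mul_left h3 hn0.le
        linarith
      · linarith)
    (fun δ hδ => by
      filter_upwards [(ht K').eventually_lt_const hδ] with n hn
      have hn0 : (0 : ℝ) < (n : ℝ) + 1 := by positivity
      rcases hbad n with ⟨h1, h2⟩ | ⟨h1, h2⟩
      · have : 0 ≤ ((n : ℝ) + 1) * -F (v n) := mul_nonneg hn0.le (by linarith)
        linarith
      · rw [one_div, inv_mul_lt_iff₀ hn0] at hn
        have h3 : ((n : ℝ) + 1) * H P₁ P₂ l (v n) < ((n : ℝ) + 1) * δ :=
          h2.trans_le ((hKF _ (hv1 n)).trans hn.le)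
        exact lt_of_mul_lt_mul_left h3 hn0.le)
  obtain ⟨hF0, w, hw1, hw2⟩ := minimizer_structure hb hH1 hC1 hC2 hl ha0 hFa hHa
  obtain ⟨C, hC⟩ := eventually_comparable (hb.contDiff_F.hasStrictFDerivAt one_ne_zero)
    ((hb.contDiff_H l).hasStrictFDerivAt one_ne_zero) hF0 hw1 hw2
    fun x hx => H_nonneg hb hH1 hl hx
  obtain ⟨N, hN⟩ := exists_nat_gt C
  obtain ⟨n, hn, hnN⟩ := ((hta.eventually hC).and
    (hφ.tendsto_atTop.eventually (eventually_ge_atTop N))).exists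
  have hCn : C ≤ (φ n : ℝ) + 1 := by
    have : (N : ℝ) ≤ φ n := by exact_mod_cast hnN
    linarith
  rcases hbad (φ n) with ⟨h1, h2⟩ | ⟨h1, h2⟩
  · have h3 := hn.1 h1
    have := mul_le_mul_of_nonneg_right hCn (show 0 ≤ -F (v (φ n)) by linarith)
    linarith
  · have h3 := hn.2 h1
    have := mul_le_mul_of_nonneg_right hCn (H_nonneg hb hH1 hl h1)
    linarith

/-- The half-line issuing from a minimizer for `λ*` in a common direction of increase of `F` and
`H_{λ*}`, and the opposite one. -/
lemma eventually_pos_line (hb : BasicConditions p γ P₁ P₂ F) {l : ℝ} {a w : X} (hFa : F a = 0)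
    (hHa : H P₁ P₂ l a = 0) (hF : 0 < fderiv ℝ F a w) (hH : 0 < fderiv ℝ (H P₁ P₂ l) a w) :
    ∃ s₀ : ℝ, 0 < s₀ ∧ ∀ s ∈ Set.Ioc 0 s₀, (0 < F (a + s • w) ∧ 0 < H P₁ P₂ l (a + s • w)) ∧
      (F (a - s • w) < 0 ∧ H P₁ P₂ l (a - s • w) < 0) := by
  have key : ∀ f : X → ℝ, ContDiff ℝ 1 f → f a = 0 → 0 < fderiv ℝ f a w →
      ∀ᶠ s in 𝓝[>] (0 : ℝ), 0 < f (a + s • w) ∧ f (a - s • w) < 0 := by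
    intro f hf hfa hfw
    have e := eventually_increment_bounds (hf.hasStrictFDerivAt one_ne_zero) hfw
    have t1 : Tendsto (fun s : ℝ => (a, s)) (𝓝[>] 0) (𝓝 (a, (0 : ℝ))) :=
      tendsto_const_nhds.prodMk_nhds nhdsWithin_le_nhds
    have t2 : Tendsto (fun s : ℝ => (a - s • w, s)) (𝓝[>] 0) (𝓝 (a, (0 : ℝ))) := by
      have : Continuous fun s : ℝ => (a - s • w, s) := by fun_prop
      have h := this.tendsto 0
      simp only [zero_smul, sub_zero] at h
      exact h.mono_left nhdsWithin_le_nhds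
    filter_upwards [t1.eventually e, t2.eventually e, self_mem_nhdsWithin] with s h1 h2 hs
    have hs' : 0 < s := hs
    have h3 := (h1 hs'.le).1
    have h4 := (h2 hs'.le).1
    simp only [sub_add_cancel, hfa] at h3 h4
    have : 0 < s * (fderiv ℝ f a w / 2) := by positivity
    constructor <;> linarith
  obtain ⟨s₀, hs₀, h⟩ := mem_nhdsGT_iff_exists_Ioc_subset.1
    ((key F hb.contDiff_F hFa hF).and (key _ (hb.contDiff_H l) hHa hH))
  refine ⟨s₀, hs₀, fun s hs => ?_⟩
  obtain ⟨⟨h1, h2⟩, h3, h4⟩ := h hs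
  exact ⟨⟨h1, h3⟩, h2, h4⟩

end Threshold

end Nehari

/-! ### The two orders of the exponents -/

namespace Nehari

section Assembly

variable {X : Type*} [NormedAddCommGroup X] [NormedSpace ℝ X]

lemma exists_neg_on_ray {q r : ℝ} {A B Φ : X → ℝ} (hq : 0 < q) (hqr : q < r)
    (hA : PosHomogeneous q A) (hB : PosHomogeneous r B)
    (hΦ : ∀ u, Φ u = 1 / q * A u - 1 / r * B u) (hd : Differentiable ℝ Φ) {u : X}
    (hAu : A u < 0) (hBu : B u < 0) : ∃ τ : ℝ, 0 < τ ∧ Φ (τ • u) < 0 := by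
  have ht := nehariScale_pos (q := q) (r := r) hAu hBu
  refine ⟨_, ht, ?_⟩
  rw [(nehariScale_smul_mem hq hqr hA hB hΦ hd hAu hBu).2]
  exact mul_neg_of_pos_of_neg (sub_pos.2 (one_div_lt_one_div_of_lt hq hqr))
    (mul_neg_of_pos_of_neg (Real.rpow_pos_of_pos ht _) hAu)

/-- A potential well together with a path of directions along which the fibering minimum tends
to `-∞` yields a local minimizer on `𝓝⁺` and a mountain pass point. -/
theorem cPlus_eq_bot_and_exists_localMin [CompleteSpace X] (hX : IsReflexive X) {q r : ℝ}
    {A B Φ g : X → ℝ} (hq : 0 < q) (hqr : q < r) (hA : PosHomogeneous q A)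
    (hB : PosHomogeneous r B) (hAc : Continuous A) (hBc : Continuous B)
    (hΦ : ∀ u, Φ u = 1 / q * A u - 1 / r * B u) (hΦd : ContDiff ℝ 1 Φ) (hΦw : WeaklyLSC Φ)
    (hg : Continuous g) (hgw : WeaklyLSC g)
    (hcoer : ∀ R, ∃ ρ, ∀ u, g u ≤ 0 → Φ u ≤ R → ‖u‖ ≤ ρ) {e : ℝ} (he : e ≤ 0)
    (hbdry : ∀ u, g u = 0 → e ≤ Φ u) {b : ℝ → X} (hb : Continuous b)
    (hA0 : ∀ s ∈ Set.Icc (0 : ℝ) 1, A (b s) < 0) (hB1 : ∀ s ∈ Set.Ioc (0 : ℝ) 1, B (b s) < 0)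
    (hB0 : B (b 0) = 0) {τ : ℝ} (hτ : 0 < τ) (hgz : g (τ • b 1) < 0) (hz : Φ (τ • b 1) < e) :
    cPlus Φ = ⊥ ∧ ∃ u ∈ nehariPlus Φ, IsLocalMin Φ u ∧
      (PalaisSmale Φ → ∃ w : X, w ≠ 0 ∧ w ≠ u ∧ IsMountainPassPoint Φ u w) := by
  have hd : Differentiable ℝ Φ := hΦd.differentiable one_ne_zero
  have hlow := exists_low_mem_nehariPlus hq hqr hA hB hAc hBc hΦ hd hb hA0 hB1 hB0 hτ
    (hz.trans_le he)
  have hΦ0 : Φ 0 = 0 := by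
    rw [hΦ, eq_zero_of_posHomogeneous hq hA, eq_zero_of_posHomogeneous (hq.trans hqr) hB]
    simp
  constructor
  · refine (EReal.eq_bot_iff_forall_lt _).2 fun R => ?_
    obtain ⟨v, hv, hvR, -⟩ := hlow R
    exact (iInf₂_le v hv).trans_lt (EReal.coe_lt_coe_iff.2 hvR)
  · obtain ⟨u, hu, hmin, hmp⟩ := exists_localMin_and_mountainPass hX hΦd hΦw hΦ0 hg hgw hcoer he
      hbdry hgz hz fun R => by
        obtain ⟨v, -, h⟩ := hlow R
        exact ⟨v, h⟩
    exact ⟨u, mem_nehariPlus_of_critical hq hqr hA hB hΦ hd hmin.fderiv_eq_zero hu, hmin, hmp⟩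

variable {p γ : ℝ} {P₁ P₂ F : X → ℝ}

lemma BasicConditions.contDiff_energy (hb : BasicConditions p γ P₁ P₂ F) (lam : ℝ) :
    ContDiff ℝ 1 (energy p γ P₁ P₂ F lam) :=
  (contDiff_const.mul (hb.contDiff_H lam)).sub (contDiff_const.mul hb.contDiff_F)

lemma BasicConditions.weaklyLSC_H (hb : BasicConditions p γ P₁ P₂ F) (lam : ℝ) :
    WeaklyLSC (H P₁ P₂ lam) := by
  have h := hb.lsc_P₁.add (hb.cont_P₂.const_mul_lsc (-lam))
  have : H P₁ P₂ lam = fun u => P₁ u + -lam * P₂ u := by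
    funext u
    rw [H]
    ring
  rwa [this]

lemma BasicConditions.weaklyLSC_energy (hb : BasicConditions p γ P₁ P₂ F) (lam : ℝ) :
    WeaklyLSC (energy p γ P₁ P₂ F lam) := by
  have h := ((hb.weaklyLSC_H lam).const_mul (one_div_pos.2 hb.p_pos)).add
    (hb.usc_F.neg.const_mul (one_div_pos.2 hb.γ_pos))
  have : energy p γ P₁ P₂ F lam =
      fun u => 1 / p * H P₁ P₂ lam u + 1 / γ * -F u := by
    funext u
    rw [energy, H]
    ring
  rwa [this]

lemma BasicConditions.energy_smul (hb : BasicConditions p γ P₁ P₂ F) (lam : ℝ) {x : ℝ}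
    (hx : 0 < x) (v : X) : energy p γ P₁ P₂ F lam (x • v) =
      1 / p * (x ^ p * H P₁ P₂ lam v) - 1 / γ * (x ^ γ * F v) := by
  rw [energy, hb.hom_F x hx, ← hb.H_smul lam x hx, H]

lemma BasicConditions.energy_zero (hb : BasicConditions p γ P₁ P₂ F) (lam : ℝ) :
    energy p γ P₁ P₂ F lam 0 = 0 := by
  rw [energy, hb.P₁_zero, hb.P₂_zero, hb.F_zero]
  simp

lemma BasicConditions.energy_anti (hb : BasicConditions p γ P₁ P₂ F) {l lam : ℝ} (h : l ≤ lam)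
    (u : X) : energy p γ P₁ P₂ F lam u ≤ energy p γ P₁ P₂ F l u := by
  have h1 := mul_le_mul_of_nonneg_right h (hb.P₂_nonneg' u)
  have h2 := mul_le_mul_of_nonneg_left h1 (one_div_pos.2 hb.p_pos).le
  rw [energy, energy]
  linarith

/-- Coercivity on `{g ≤ 0}` may be checked on the rays issuing from `{P₁ = 1}`. -/
lemma BasicConditions.coercive_of_rays (hb : BasicConditions p γ P₁ P₂ F) {Φ g : X → ℝ}
    (h : ∀ R, ∃ M : ℝ, 0 < M ∧ ∀ (x : ℝ) (v : X), 0 < x → P₁ v = 1 → g (x • v) ≤ 0 →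
      Φ (x • v) ≤ R → x ≤ M)
    (R : ℝ) : ∃ ρ, ∀ u, g u ≤ 0 → Φ u ≤ R → ‖u‖ ≤ ρ := by
  obtain ⟨M, hM, hx⟩ := h R
  obtain ⟨ρ, hρ, hnorm⟩ := hb.exists_norm_le (M ^ p)
  refine ⟨ρ, fun u hgu hu => ?_⟩
  by_cases h0 : u = 0
  · simpa [h0] using hρ
  obtain ⟨x, v, hx0, hv, rfl⟩ := hb.exists_normalized h0
  refine hnorm _ ?_
  rw [hb.hom_P₁ x hx0, hv, mul_one]
  exact Real.rpow_le_rpow hx0.le (hx x v hx0 hv hgu hu) hb.p_pos.le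

/-- The case `p < γ`. -/
theorem exists_minimization_beyond_of_lt [CompleteSpace X] (hX : IsReflexive X)
    (hb : BasicConditions p γ P₁ P₂ F) (hH1 : CondH1 P₁ P₂ F) (hS : CondS P₁)
    (hC1 : CondC1 P₁ P₂ F) (hC2 : CondC2 P₁ P₂ F) {l : ℝ}
    (hl : lambdaStar P₁ P₂ F = (l : EReal)) (hpγ : p < γ) :
    ∃ ε : ℝ, 0 < ε ∧ ∀ lam : ℝ, l < lam → lam < l + ε →
      cPlus (energy p γ P₁ P₂ F lam) = ⊥ ∧
      ∃ u ∈ nehariPlus (energy p γ P₁ P₂ F lam), IsLocalMin (energy p γ P₁ P₂ F lam) u ∧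
        (PalaisSmale (energy p γ P₁ P₂ F lam) → ∃ w : X, w ≠ 0 ∧ w ≠ u ∧
          IsMountainPassPoint (energy p γ P₁ P₂ F lam) u w) := by
  have hp := hb.p_pos
  have hγ := hb.γ_pos
  have hlpos : 0 < l := EReal.coe_pos.1 (hl ▸ lambdaStar_pos hb)
  obtain ⟨K, hK, hKP⟩ := hb.exists_P₂_le
  obtain ⟨C, hC, hcomp⟩ := exists_comparison hX hb hH1 hS hC1 hC2 hl
  obtain ⟨a, ha0, hFa, hHa⟩ := exists_minimizer hX hb hH1 hS hl
  obtain ⟨hFa0, w, hw1, hw2⟩ := minimizer_structure hb hH1 hC1 hC2 hl ha0 hFa hHa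
  obtain ⟨s₀, hs₀, hline⟩ := eventually_pos_line hb hFa0 hHa hw1 hw2
  have hP₂a : 0 < P₂ a := by
    have h1 := hb.P₁_pos ha0
    rw [H] at hHa
    by_contra! h
    nlinarith
  -- Going backwards from `a` makes `F` and `H_l` negative; `F` returns to `0` at `s = 0`.
  let b : ℝ → X := fun s => a - (s * s₀) • w
  have hbc : Continuous b := by fun_prop
  have hb0 : b 0 = a := by simp [b]
  have hbneg : ∀ s ∈ Set.Ioc (0 : ℝ) 1, F (b s) < 0 ∧ H P₁ P₂ l (b s) < 0 := fun s hs =>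
    (hline (s * s₀) ⟨mul_pos hs.1 hs₀, mul_le_of_le_one_left hs₀.le hs.2⟩).2
  have h11 : (1 : ℝ) ∈ Set.Ioc (0 : ℝ) 1 := ⟨one_pos, le_rfl⟩
  obtain ⟨T, hT, hTneg⟩ := exists_neg_on_ray hp hpγ (hb.H_smul l) hb.hom_F
    (fun _ => rfl) ((hb.contDiff_energy l).differentiable one_ne_zero) (hbneg 1 h11).2
    (hbneg 1 h11).1
  set z := T • b 1 with hz
  have hHz : H P₁ P₂ l z < 0 := by
    rw [hz, hb.H_smul l T hT]
    exact mul_neg_of_pos_of_neg (Real.rpow_pos_of_pos hT p) (hbneg 1 h11).2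
  -- On the boundary of the well the energy will be at least `-τ` times this model function, with
  -- `D` free of `τ`. As `z` was fixed beforehand, `τ` can then be taken small.
  obtain ⟨D, hD, hDx⟩ := exists_rpow_sub_le hp hpγ (a := 2 * K / p) (b := 1 / (l * C * γ))
    (by positivity) (by positivity)
  obtain ⟨τ, hτ, hτz, hτD⟩ : ∃ τ : ℝ, 0 < τ ∧ H P₁ P₂ l z + τ * P₂ z < 0 ∧
      energy p γ P₁ P₂ F l z < -(τ * D) := by
    have t1 : Tendsto (fun τ : ℝ => H P₁ P₂ l z + τ * P₂ z) (𝓝[>] 0) (𝓝 (H P₁ P₂ l z)) := by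
      have : Continuous fun τ : ℝ => H P₁ P₂ l z + τ * P₂ z := by fun_prop
      simpa using (this.tendsto 0).mono_left nhdsWithin_le_nhds
    have t2 : Tendsto (fun τ : ℝ => -(τ * D)) (𝓝[>] 0) (𝓝 0) := by
      have : Continuous fun τ : ℝ => -(τ * D) := by fun_prop
      simpa using (this.tendsto 0).mono_left nhdsWithin_le_nhds
    obtain ⟨τ, ⟨h1, h2⟩, h3⟩ := (((t1.eventually_lt_const hHz).and
      (t2.eventually_const_lt hTneg)).and self_mem_nhdsWithin).exists
    exact ⟨τ, h3, h1, h2⟩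
  refine ⟨τ, hτ, fun lam hlam1 hlam2 => ?_⟩
  -- This is `H_{l-τ}`. On `{P₁ = 1, g ≤ 0}` it gives `-H_l ≥ τ P₂ ≥ τ / l`, which the comparison
  -- turns into a positive lower bound for `-F`.
  let g : X → ℝ := fun u => H P₁ P₂ l u + τ * P₂ u
  have hghom : ∀ (x : ℝ) (v : X), 0 < x → g (x • v) = x ^ p * g v := by
    intro x v hx
    change H P₁ P₂ l (x • v) + τ * P₂ (x • v) = x ^ p * (H P₁ P₂ l v + τ * P₂ v)
    rw [hb.H_smul l x hx, hb.hom_P₂ x hx]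
    ring
  have hgF : ∀ v, P₁ v = 1 → g v ≤ 0 → τ / (l * C) ≤ -F v := by
    intro v hv hgv
    have hgv' : H P₁ P₂ l v + τ * P₂ v ≤ 0 := hgv
    have h0 : 0 ≤ τ * P₂ v := mul_nonneg hτ.le (hb.P₂_nonneg' v)
    have hH0 : H P₁ P₂ l v ≤ 0 := by linarith
    have h1 : 1 ≤ l * P₂ v := by rw [H, hv] at hH0; linarith
    have h2 : τ / l ≤ τ * P₂ v := by
      rw [div_le_iff₀ hlpos]
      nlinarith
    have h3 : 0 < τ / l := by positivity
    have hFv : F v < 0 := by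
      by_contra! h
      have := H_nonneg hb hH1 hl h
      linarith
    have h4 := (hcomp v hv).1 hFv
    rw [← div_div, div_le_iff₀' hC]
    linarith
  refine cPlus_eq_bot_and_exists_localMin (g := g) (e := -(τ * D)) (b := b) (τ := T) hX hp hpγ
    (hb.H_smul lam) hb.hom_F (hb.contDiff_H lam).continuous hb.contDiff_F.continuous
    (fun _ => rfl) (hb.contDiff_energy lam) (hb.weaklyLSC_energy lam)
    ((hb.contDiff_H l).continuous.add (continuous_const.mul hb.contDiff_P₂.continuous))
    ((hb.weaklyLSC_H l).add (hb.cont_P₂.const_mul_lsc τ)) (hb.coercive_of_rays fun R => ?_)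
    (by have := mul_pos hτ hD; linarith) (fun u hu => ?_) hbc (fun s hs => ?_)
    (fun s hs => (hbneg s hs).1) (by rw [hb0, hFa0]) hT hτz
    ((hb.energy_anti hlam1.le z).trans_lt hτD)
  · obtain ⟨M, hM, hMx⟩ := exists_bound_of_rpow_sub_le hp hpγ (lam * K / p)
      (b := τ / (l * C) / γ) (by positivity) R
    refine ⟨M, hM, fun x v hx hv hgv hΦ => hMx x hx ?_⟩
    have hxp : 0 < x ^ p := Real.rpow_pos_of_pos hx p
    have hxγ : 0 < x ^ γ := Real.rpow_pos_of_pos hx γ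
    rw [hghom x v hx] at hgv
    have h1 := hgF v hv (nonpos_of_mul_nonpos_right hgv hxp)
    rw [hb.energy_smul lam hx] at hΦ
    have h2 : -(lam * K) ≤ H P₁ P₂ lam v := by
      have h3 := hKP v
      rw [hv, mul_one] at h3
      have := mul_le_mul_of_nonneg_left h3 (hlpos.trans hlam1).le
      rw [H, hv]
      linarith
    have h4 : 1 / p * (x ^ p * -(lam * K)) ≤ 1 / p * (x ^ p * H P₁ P₂ lam v) := by gcongr
    have h5 : 1 / γ * (x ^ γ * (τ / (l * C))) ≤ 1 / γ * (x ^ γ * -F v) := by gcongr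
    calc τ / (l * C) / γ * x ^ γ - lam * K / p * x ^ p
        = 1 / γ * (x ^ γ * (τ / (l * C))) + 1 / p * (x ^ p * -(lam * K)) := by ring
      _ ≤ 1 / γ * (x ^ γ * -F v) + 1 / p * (x ^ p * H P₁ P₂ lam v) := add_le_add h5 h4
      _ ≤ R := by linarith
  · by_cases h0 : u = 0
    · rw [h0, hb.energy_zero]
      have := mul_pos hτ hD
      linarith
    obtain ⟨x, v, hx, hv, rfl⟩ := hb.exists_normalized h0
    have hxp : 0 < x ^ p := Real.rpow_pos_of_pos hx p
    have hxγ : 0 < x ^ γ := Real.rpow_pos_of_pos hx γ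
    rw [hghom x v hx] at hu
    have hgv : g v = 0 := (mul_eq_zero.1 hu).resolve_left hxp.ne'
    have hgv' : H P₁ P₂ l v + τ * P₂ v = 0 := hgv
    have h1 := hgF v hv hgv.le
    -- One `τ` comes from `g v = 0`, the other from `lam - l < τ`.
    have h2 : -(2 * τ * K) ≤ H P₁ P₂ lam v := by
      have h3 := hKP v
      rw [hv, mul_one] at h3
      have h4 := mul_le_mul_of_nonneg_left h3 (show 0 ≤ 2 * τ by positivity)
      have h5 := mul_le_mul_of_nonneg_right hlam2.le (hb.P₂_nonneg' v)
      rw [H] at hgv' ⊢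
      linarith
    have h4 : 1 / p * (x ^ p * -(2 * τ * K)) ≤ 1 / p * (x ^ p * H P₁ P₂ lam v) := by gcongr
    have h5 : 1 / γ * (x ^ γ * (τ / (l * C))) ≤ 1 / γ * (x ^ γ * -F v) := by gcongr
    have h6 := mul_le_mul_of_nonneg_left (hDx x hx) hτ.le
    rw [hb.energy_smul lam hx]
    calc -(τ * D) ≤ -(τ * (2 * K / p * x ^ p - 1 / (l * C * γ) * x ^ γ)) := neg_le_neg h6
      _ = 1 / p * (x ^ p * -(2 * τ * K)) + 1 / γ * (x ^ γ * (τ / (l * C))) := by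
        field_simp
        ring
      _ ≤ 1 / p * (x ^ p * H P₁ P₂ lam v) + 1 / γ * (x ^ γ * -F v) := add_le_add h4 h5
      _ = _ := by ring
  -- At `s = 0` negativity comes from `lam > l` and `P₂ a > 0`, as `H_l a = 0`.
  · rcases hs.1.eq_or_lt with rfl | h0
    · rw [hb0]
      have := mul_lt_mul_of_pos_right hlam1 hP₂a
      rw [H] at hHa ⊢
      linarith
    · have h1 := (hbneg s ⟨h0, hs.2⟩).2
      have := mul_le_mul_of_nonneg_right hlam1.le (hb.P₂_nonneg' (b s))
      rw [H] at h1 ⊢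
      linarith

/-- The case `γ < p`. -/
theorem exists_minimization_beyond_of_gt [CompleteSpace X] (hX : IsReflexive X)
    (hb : BasicConditions p γ P₁ P₂ F) (hH1 : CondH1 P₁ P₂ F) (hS : CondS P₁)
    (hC1 : CondC1 P₁ P₂ F) (hC2 : CondC2 P₁ P₂ F) {l : ℝ}
    (hl : lambdaStar P₁ P₂ F = (l : EReal)) (hγp : γ < p) :
    ∃ ε : ℝ, 0 < ε ∧ ∀ lam : ℝ, l < lam → lam < l + ε →
      cPlus (energy p γ P₁ P₂ F lam) = ⊥ ∧
      ∃ u ∈ nehariPlus (energy p γ P₁ P₂ F lam), IsLocalMin (energy p γ P₁ P₂ F lam) u ∧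
        (PalaisSmale (energy p γ P₁ P₂ F lam) → ∃ w : X, w ≠ 0 ∧ w ≠ u ∧
          IsMountainPassPoint (energy p γ P₁ P₂ F lam) u w) := by
  have hp := hb.p_pos
  have hγ := hb.γ_pos
  -- The roles of `F` and `H_λ` are exchanged, with signs reversed.
  have hform : ∀ (lam : ℝ) (u : X), energy p γ P₁ P₂ F lam u =
      1 / γ * (-F u) - 1 / p * (-H P₁ P₂ lam u) := by
    intro lam u
    rw [energy, H]
    ring
  have hA : PosHomogeneous γ fun u => -F u := fun t ht u => by
    simp only [hb.hom_F t ht]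
    ring
  have hB : ∀ lam, PosHomogeneous p fun u => -H P₁ P₂ lam u := fun lam t ht u => by
    simp only [hb.H_smul lam t ht]
    ring
  obtain ⟨K, hK, hKP⟩ := hb.exists_P₂_le
  obtain ⟨K', hK', hKF⟩ := hb.exists_F_le
  obtain ⟨C, hC, hcomp⟩ := exists_comparison hX hb hH1 hS hC1 hC2 hl
  obtain ⟨a, ha0, hFa, hHa⟩ := exists_minimizer hX hb hH1 hS hl
  obtain ⟨hFa0, w, hw1, hw2⟩ := minimizer_structure hb hH1 hC1 hC2 hl ha0 hFa hHa
  obtain ⟨s₀, hs₀, hline⟩ := eventually_pos_line hb hFa0 hHa hw1 hw2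
  have hP₂a : 0 < P₂ a := by
    have h1 := hb.P₁_pos ha0
    have h2 := hb.P₂_nonneg' a
    rcases h2.eq_or_lt with h | h
    · rw [H, ← h] at hHa
      linarith
    · exact h
  let b : ℝ → X := fun s => a + (s * s₀) • w
  have hbc : Continuous b := by fun_prop
  have hb0 : b 0 = a := by simp [b]
  have hbpos : ∀ s ∈ Set.Ioc (0 : ℝ) 1, 0 < F (b s) ∧ 0 < H P₁ P₂ l (b s) := fun s hs =>
    (hline (s * s₀) ⟨mul_pos hs.1 hs₀, mul_le_of_le_one_left hs₀.le hs.2⟩).1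
  have h11 : (1 : ℝ) ∈ Set.Ioc (0 : ℝ) 1 := ⟨one_pos, le_rfl⟩
  obtain ⟨T, hT, hTneg⟩ := exists_neg_on_ray hγ hγp hA (hB l) (hform l)
    ((hb.contDiff_energy l).differentiable one_ne_zero) (u := b 1)
    (neg_neg_of_pos (hbpos 1 h11).1) (neg_neg_of_pos (hbpos 1 h11).2)
  set z := T • b 1 with hz
  have hFz : 0 < F z := by
    rw [hz, hb.hom_F T hT]
    exact mul_pos (Real.rpow_pos_of_pos hT γ) (hbpos 1 h11).1
  obtain ⟨D, hD, hDx⟩ := exists_rpow_sub_le hγ hγp (a := 1 / γ) (b := 1 / (2 * C * p))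
    (by positivity) (by positivity)
  obtain ⟨τ, hτ, hτz, hτD⟩ : ∃ τ : ℝ, 0 < τ ∧ τ * P₁ z ^ (γ / p) + -F z < 0 ∧
      energy p γ P₁ P₂ F l z < -(τ * D) := by
    have t1 : Tendsto (fun τ : ℝ => τ * P₁ z ^ (γ / p) + -F z) (𝓝[>] 0) (𝓝 (-F z)) := by
      have : Continuous fun τ : ℝ => τ * P₁ z ^ (γ / p) + -F z := by fun_prop
      simpa using (this.tendsto 0).mono_left nhdsWithin_le_nhds
    have t2 : Tendsto (fun τ : ℝ => -(τ * D)) (𝓝[>] 0) (𝓝 0) := by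
      have : Continuous fun τ : ℝ => -(τ * D) := by fun_prop
      simpa using (this.tendsto 0).mono_left nhdsWithin_le_nhds
    obtain ⟨τ, ⟨h1, h2⟩, h3⟩ := (((t1.eventually_lt_const (neg_neg_of_pos hFz)).and
      (t2.eventually_const_lt hTneg)).and self_mem_nhdsWithin).exists
    exact ⟨τ, h3, h1, h2⟩
  -- Passing from `H_l` to `H_λ` may cost at most half of the bound `τ / C`, and `H_λ (b 1)` must
  -- stay positive.
  obtain ⟨ε, hε, hεK, hεb⟩ : ∃ ε : ℝ, 0 < ε ∧ ε * K < τ / (2 * C) ∧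
      ε * P₂ (b 1) < H P₁ P₂ l (b 1) := by
    have t : ∀ k : ℝ, Tendsto (fun ε : ℝ => ε * k) (𝓝[>] 0) (𝓝 0) := fun k => by
      have : Continuous fun ε : ℝ => ε * k := by fun_prop
      simpa using (this.tendsto 0).mono_left nhdsWithin_le_nhds
    obtain ⟨ε, ⟨h1, h2⟩, h3⟩ := ((((t K).eventually_lt_const
      (show 0 < τ / (2 * C) by positivity)).and
      ((t (P₂ (b 1))).eventually_lt_const (hbpos 1 h11).2)).and self_mem_nhdsWithin).exists
    exact ⟨ε, h3, h1, h2⟩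
  refine ⟨ε, hε, fun lam hlam1 hlam2 => ?_⟩
  have hlamH : ∀ u, H P₁ P₂ l u - ε * P₂ u ≤ H P₁ P₂ lam u := by
    intro u
    have := mul_le_mul_of_nonneg_right hlam2.le (hb.P₂_nonneg' u)
    rw [H, H]
    linarith
  -- Here `H_λ a < 0`, so the curve cannot start at `a`. It starts at the last zero of `H_λ`, where
  -- `F` is still positive.
  obtain ⟨s₁, ⟨hs₁0, hs₁1⟩, hs₁z, hs₁⟩ := exists_last_zero
    (f := fun s => H P₁ P₂ lam (b s)) ((hb.contDiff_H lam).continuous.comp hbc)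
    (by
      have := mul_lt_mul_of_pos_right hlam1 hP₂a
      simp only [hb0]
      rw [H] at hHa ⊢
      linarith)
    (by
      have := hlamH (b 1)
      linarith)
  -- The exponent `γ / p` makes `g` homogeneous of degree `γ`; on `{P₁ = 1}` the well is `{F ≥ τ}`,
  -- where the comparison bounds `H_l` below by `τ / C`.
  let g : X → ℝ := fun u => τ * P₁ u ^ (γ / p) + -F u
  have hghom : ∀ (x : ℝ) (v : X), 0 < x → P₁ v = 1 → g (x • v) = x ^ γ * (τ - F v) := by
    intro x v hx hv
    change τ * P₁ (x • v) ^ (γ / p) + -F (x • v) = x ^ γ * (τ - F v)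
    rw [hb.hom_P₁ x hx, hv, mul_one, hb.hom_F x hx, ← Real.rpow_mul hx.le, mul_div_cancel₀ _ hp.ne']
    ring
  have hHlow : ∀ v, P₁ v = 1 → τ ≤ F v → τ / (2 * C) ≤ H P₁ P₂ lam v := by
    intro v hv hF
    have h1 := (hcomp v hv).2 (hτ.le.trans hF)
    have h2 : τ / C ≤ H P₁ P₂ l v := by
      rw [div_le_iff₀' hC]
      linarith
    have h3 := hKP v
    rw [hv, mul_one] at h3
    have h4 := mul_le_mul_of_nonneg_left h3 hε.le
    have h5 := hlamH v
    have h6 : τ / C = τ / (2 * C) + τ / (2 * C) := by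
      field_simp
      ring
    linarith
  have hseg : ∀ s ∈ Set.Icc (0 : ℝ) 1, s₁ + s * (1 - s₁) ∈ Set.Ioc (0 : ℝ) 1 := by
    intro s hs
    have h1 : 0 ≤ s * (1 - s₁) := mul_nonneg hs.1 (by linarith)
    have h2 : s * (1 - s₁) ≤ 1 - s₁ := mul_le_of_le_one_left (by linarith) hs.2
    constructor <;> linarith
  have hb1 : b (s₁ + 1 * (1 - s₁)) = b 1 := by
    congr 1
    ring
  refine cPlus_eq_bot_and_exists_localMin (g := g) (e := -(τ * D))
    (b := fun s => b (s₁ + s * (1 - s₁))) (τ := T) hX hγ hγp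
    hA (hB lam) hb.contDiff_F.continuous.neg (hb.contDiff_H lam).continuous.neg
    (hform lam) (hb.contDiff_energy lam) (hb.weaklyLSC_energy lam)
    ((continuous_const.mul (hb.contDiff_P₁.continuous.rpow_const
      fun _ => Or.inr (by positivity))).add hb.contDiff_F.continuous.neg)
    (((hb.lsc_P₁.rpow_const hb.P₁_nonneg (div_pos hγ hp)).const_mul hτ).add hb.usc_F.neg)
    (hb.coercive_of_rays fun R => ?_)
    (by have := mul_pos hτ hD; linarith) (fun u hu => ?_) (by fun_prop)
    (fun s hs => neg_neg_of_pos (hbpos _ (hseg s hs)).1)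
    (fun s hs => neg_neg_of_pos (hs₁ _ ⟨?_, (hseg s ⟨hs.1.le, hs.2⟩).2⟩))
    (by simpa using hs₁z) hT (by simpa only [hb1] using hτz)
    (by simpa only [hb1] using (hb.energy_anti hlam1.le z).trans_lt hτD)
  · obtain ⟨M, hM, hMx⟩ := exists_bound_of_rpow_sub_le hγ hγp (K' / γ)
      (b := τ / (2 * C) / p) (by positivity) R
    refine ⟨M, hM, fun x v hx hv hgv hΦ => hMx x hx ?_⟩
    have hxp : 0 < x ^ p := Real.rpow_pos_of_pos hx p
    have hxγ : 0 < x ^ γ := Real.rpow_pos_of_pos hx γ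
    rw [hghom x v hx hv] at hgv
    have h1 := hHlow v hv (by linarith [nonpos_of_mul_nonpos_right hgv hxγ])
    have h2 := hKF v hv
    rw [hb.energy_smul lam hx] at hΦ
    have h4 : 1 / p * (x ^ p * (τ / (2 * C))) ≤ 1 / p * (x ^ p * H P₁ P₂ lam v) := by gcongr
    have h5 : 1 / γ * (x ^ γ * F v) ≤ 1 / γ * (x ^ γ * K') := by gcongr
    calc τ / (2 * C) / p * x ^ p - K' / γ * x ^ γ
        = 1 / p * (x ^ p * (τ / (2 * C))) - 1 / γ * (x ^ γ * K') := by ring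
      _ ≤ R := by linarith
  · by_cases h0 : u = 0
    · rw [h0, hb.energy_zero]
      have := mul_pos hτ hD
      linarith
    obtain ⟨x, v, hx, hv, rfl⟩ := hb.exists_normalized h0
    have hxp : 0 < x ^ p := Real.rpow_pos_of_pos hx p
    have hxγ : 0 < x ^ γ := Real.rpow_pos_of_pos hx γ
    rw [hghom x v hx hv] at hu
    have hFv : F v = τ := by linarith [(mul_eq_zero.1 hu).resolve_left hxγ.ne']
    have h1 := hHlow v hv hFv.ge
    have h4 : 1 / p * (x ^ p * (τ / (2 * C))) ≤ 1 / p * (x ^ p * H P₁ P₂ lam v) := by gcongr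
    have h6 := mul_le_mul_of_nonneg_left (hDx x hx) hτ.le
    rw [hb.energy_smul lam hx, hFv]
    calc -(τ * D) ≤ -(τ * (1 / γ * x ^ γ - 1 / (2 * C * p) * x ^ p)) := neg_le_neg h6
      _ = 1 / p * (x ^ p * (τ / (2 * C))) - 1 / γ * (x ^ γ * τ) := by
        field_simp
        ring
      _ ≤ _ := sub_le_sub_right h4 _
  · have := mul_pos hs.1 (show 0 < 1 - s₁ by linarith)
    linarith

end Assembly

end Nehari

/-! ### Conclusion -/

theorem theorem3 {X : Type*} [NormedAddCommGroup X] [NormedSpace ℝ X] [CompleteSpace X]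
    (hX : IsReflexive X) (p γ : ℝ) (P₁ P₂ F : X → ℝ)
    (hbasic : BasicConditions p γ P₁ P₂ F)
    (hH1 : CondH1 P₁ P₂ F) (hS : CondS P₁)
    (hC1 : CondC1 P₁ P₂ F) (hC2 : CondC2 P₁ P₂ F)
    (hmu : muStar P₁ P₂ F < lambdaStar P₁ P₂ F) :
    ∃ ε : ℝ, 0 < ε ∧ ∀ lam : ℝ,
      lambdaStar P₁ P₂ F < (lam : EReal) →
      (lam : EReal) < lambdaStar P₁ P₂ F + (ε : EReal) →
      cPlus (energy p γ P₁ P₂ F lam) = ⊥ ∧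
      ∃ u ∈ nehariPlus (energy p γ P₁ P₂ F lam),
        IsLocalMin (energy p γ P₁ P₂ F lam) u ∧
        (PalaisSmale (energy p γ P₁ P₂ F lam) →
          ∃ w : X, w ≠ 0 ∧ w ≠ u ∧
            IsMountainPassPoint (energy p γ P₁ P₂ F lam) u w) := by
  have hpos := lambdaStar_pos hbasic
  induction h : lambdaStar P₁ P₂ F using EReal.rec with
  | bot => exact absurd (h ▸ hpos) not_lt_bot
  | top => exact ⟨1, one_pos, fun lam h1 _ => absurd h1 (not_lt.2 le_top)⟩
  | coe l =>
    have key : ∃ ε : ℝ, 0 < ε ∧ ∀ lam : ℝ, l < lam → lam < l + ε →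
        cPlus (energy p γ P₁ P₂ F lam) = ⊥ ∧
        ∃ u ∈ nehariPlus (energy p γ P₁ P₂ F lam), IsLocalMin (energy p γ P₁ P₂ F lam) u ∧
          (PalaisSmale (energy p γ P₁ P₂ F lam) → ∃ w : X, w ≠ 0 ∧ w ≠ u ∧
            IsMountainPassPoint (energy p γ P₁ P₂ F lam) u w) := by
      rcases lt_or_gt_of_ne hbasic.p_ne_γ with hlt | hgt
      · exact exists_minimization_beyond_of_lt hX hbasic hH1 hS hC1 hC2 h hlt
      · exact exists_minimization_beyond_of_gt hX hbasic hH1 hS hC1 hC2 h hgt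
    obtain ⟨ε, hε, hmain⟩ := key
    refine ⟨ε, hε, fun lam h1 h2 => hmain lam (EReal.coe_lt_coe_iff.1 h1) ?_⟩
    rw [← EReal.coe_add] at h2
    exact EReal.coe_lt_coe_iff.1 h2
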